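/- **Setting.** A scalar field is a topological space $X$ with a continuous function $f:X\to\mathbb R$. It is *constructible* if, up to function-preserving homeomorphism, it is glued from finitely many compact, locally path-connected critical fibers $V_i$ at heights $a_0<\dots<a_n$ and cylinders $E_i\times[a_i,a_{i+1}]$ ($E_i$ compact, locally path-connected) along continuous attaching maps $E_i\to V_i$ and $E_i\to V_{i+1}$, with $f$ the height. Its *Reeb graph* $\mathcal R_f$ is the quotient of $X$ by the relation "same connected component of a level set of $f$", with the induced function $\tilde f$. Two Reeb graphs are *Reeb graph isomorphic* if there is a homeomorphism between them commuting with the induced functions. The vertices (critical points) of $\mathcal R_f$ are the points without an open neighbourhood that $\tilde f$ maps homeomorphically onto an open subset of $\mathbb R$; its edges are the connected components of the complement of the vertices, and two Reeb graphs are *graph isomorphic* if the resulting multigraphs (function values being ignored) are isomorphic. Fix a field $k$ of coefficients. The *extended persistence diagram* $\mathrm{ExDgm}(f)$ is the union over $d\ge 0$ of the multisets $\mathrm{Ord}_d,\mathrm{Rel}_d,\mathrm{Ext}_d$ of points $(s,t)$ recording the critical values $s,t$ at which the classes of the sequence $H_d(R_a)$ ($a$ increasing) followed by $H_d(R,R^a)$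 ($a$ decreasing) are born and die; here $R=\mathcal R_f$, $R_a=\tilde f^{-1}(-\infty,a]$, $R^a=\tilde f^{-1}[a,\infty)$, and $H_d$ is singular homology. The *ungraded bottleneck distance* is $d_b=\inf_M c(M)$ over all bijections $M$ between subsets of the off-diagonal points of the two diagrams, where $c(M)$ is the supremum of the numbers $\|x-M(x)\|_\infty$ for matched $x$ and $\tfrac12|x_1-x_2|$ for unmatched $(x_1,x_2)$. The *graded bottleneck distance* $d_B$ is the maximum of the distances $d_b$ between the respective subdiagrams $\mathrm{Ext}_0,\mathrm{Ext}_1,\mathrm{Rel}_1,\mathrm{Ord}_0$. A Reeb graph is *generic* if its vertices have distinct function values and no critical value is a coordinate of two points of the diagram. A distance $d$ is *isomorphism invariant* if $d(\mathcal R_f,\mathcal R_g)=0$ holds if and only if $\mathcal R_f$ and $\mathcal R_g$ are Reeb graph isomorphic. **Theorem (The bottleneck distance is not isomorphism invariant).** For every field $k$, neither $d_b$ nor $d_B$ is isomorphism invariant, not even on the generic Reeb graphs of constructible scalar fields on path-connected spaces. More precisely, there exist constructible scalar fields $(X,f)$, $(Y,g)$ on path-connected spaces such that $\mathcal R_f$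 and $\mathcal R_g$ are graph isomorphic but not Reeb graph isomorphic, and such that, for every field $k$, both Reeb graphs are generic, the diagrams $\mathrm{ExDgm}(f)$ and $\mathrm{ExDgm}(g)$ coincide (in every dimension and every class), and $d_b(\mathcal R_f,\mathcal R_g)=d_B(\mathcal R_f,\mathcal R_g)=0$. -/

import Mathlib

open scoped ENNReal

universe u

noncomputable section

/-! ### Scalar fields and constructibility -/

/-- A scalar field (`ℝ`-space): a topological space with a continuous real-valued function. -/
structure ScalarField where
  carrier : Type
  [top : TopologicalSpace carrier]
  toFun : carrier → ℝ
  continuous_toFun : Continuous toFun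

attribute [instance] ScalarField.top

namespace ScalarField

/-- A function preserving homeomorphism between two scalar fields. -/
def Isomorphic (X Y : ScalarField) : Prop :=
  ∃ h : X.carrier ≃ₜ Y.carrier, ∀ x, Y.toFun (h x) = X.toFun x

end ScalarField

/-- The data from which a constructible scalar field is built: critical values
`a 0 < ⋯ < a n`, critical fibers `V i`, non-critical fibers `E i` (all of them compact and locally
path-connected), and continuous attaching maps from `E i` to `V i` and to `V (i + 1)`. -/
structure ConstructibleData where
  n : ℕ
  a : Fin (n + 1) → ℝ
  a_strictMono : StrictMono a
  V : Fin (n + 1) → Type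
  E : Fin n → Type
  [topV : ∀ i, TopologicalSpace (V i)]
  [topE : ∀ i, TopologicalSpace (E i)]
  compactV : ∀ i, CompactSpace (V i)
  compactE : ∀ i, CompactSpace (E i)
  locPathV : ∀ i, LocallyPathConnectedSpace (V i)
  locPathE : ∀ i, LocallyPathConnectedSpace (E i)
  lower : ∀ i : Fin n, E i → V i.castSucc
  upper : ∀ i : Fin n, E i → V i.succ
  continuous_lower : ∀ i, Continuous (lower i)
  continuous_upper : ∀ i, Continuous (upper i)

namespace ConstructibleData

attribute [instance] topV topE

variable (D : ConstructibleData)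

/-- The disjoint union of the critical fibers `V i` (thought of as `V i × {a i}`) and of the
cylinders `E i × [a i, a (i + 1)]`. -/
abbrev Pieces : Type :=
  (Σ i, D.V i) ⊕ (Σ i : Fin D.n, D.E i × Set.Icc (D.a i.castSucc) (D.a i.succ))

/-- Second coordinate on the disjoint union of the pieces. -/
def piecesHeight : D.Pieces → ℝ
  | Sum.inl v => D.a v.1
  | Sum.inr p => (p.2.2 : ℝ)

/-- The gluing: the bottom of each cylinder is attached by `lower`, the top by `upper`. -/
inductive Glue : D.Pieces → D.Pieces → Prop
  | lower (i : Fin D.n) (e : D.E i) (t : Set.Icc (D.a i.castSucc) (D.a i.succ))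
      (ht : (t : ℝ) = D.a i.castSucc) :
      Glue (Sum.inr ⟨i, e, t⟩) (Sum.inl ⟨i.castSucc, D.lower i e⟩)
  | upper (i : Fin D.n) (e : D.E i) (t : Set.Icc (D.a i.castSucc) (D.a i.succ))
      (ht : (t : ℝ) = D.a i.succ) :
      Glue (Sum.inr ⟨i, e, t⟩) (Sum.inl ⟨i.succ, D.upper i e⟩)

theorem piecesHeight_eq_of_glue {p q : D.Pieces} (h : D.Glue p q) :
    D.piecesHeight p = D.piecesHeight q := by
  cases h with
  | lower i e t ht => exact ht
  | upper i e t ht => exact ht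

theorem continuous_piecesHeight : Continuous D.piecesHeight := by
  refine continuous_sum_dom.2 ⟨?_, ?_⟩
  · exact continuous_sigma fun i => (continuous_const : Continuous fun _ : D.V i => D.a i)
  · exact continuous_sigma fun i => continuous_subtype_val.comp continuous_snd

/-- The constructible scalar field glued from the data, with projection to the second coordinate. -/
def glued : ScalarField where
  carrier := Quot D.Glue
  toFun := Quot.lift D.piecesHeight fun _ _ h => D.piecesHeight_eq_of_glue h
  continuous_toFun := continuous_quot_lift _ D.continuous_piecesHeight

end ConstructibleData

namespace ScalarField

/-- A scalar field is constructible if it is isomorphic to one glued from constructible data. -/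
def IsConstructible (X : ScalarField) : Prop :=
  ∃ D : ConstructibleData, X.Isomorphic D.glued

/-! ### The Reeb graph -/

/-- Two points are equivalent if they lie in the same connected component of a level set. -/
def reebSetoid (X : ScalarField) : Setoid X.carrier where
  r x y := y ∈ connectedComponentIn (X.toFun ⁻¹' {X.toFun x}) x
  iseqv :=
    { refl := fun x => mem_connectedComponentIn rfl
      symm := by
        intro x y h
        have hy : y ∈ X.toFun ⁻¹' {X.toFun x} := connectedComponentIn_subset _ _ h
        have hy' : X.toFun y = X.toFun x := hy
        have he := connectedComponentIn_eq h
        change x ∈ connectedComponentIn (X.toFun ⁻¹' {X.toFun y}) y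
        rw [hy', ← he]
        exact mem_connectedComponentIn rfl
      trans := by
        intro x y z h h'
        have hy : y ∈ X.toFun ⁻¹' {X.toFun x} := connectedComponentIn_subset _ _ h
        have hy' : X.toFun y = X.toFun x := hy
        change z ∈ connectedComponentIn (X.toFun ⁻¹' {X.toFun y}) y at h'
        rw [hy', ← connectedComponentIn_eq h] at h'
        exact h' }

/-- The Reeb graph of a scalar field: the quotient space with the induced function. The Reeb graph
is itself a scalar field. -/
def reeb (X : ScalarField) : ScalarField where
  carrier := Quotient X.reebSetoid
  toFun := Quotient.lift X.toFun fun x y h =>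
    (show y ∈ X.toFun ⁻¹' {X.toFun x} from connectedComponentIn_subset _ _ h).symm
  continuous_toFun := X.continuous_toFun.quotient_lift _

/-- Reeb graph isomorphism: a function preserving homeomorphism between the Reeb graphs. -/
def ReebIsomorphic (X Y : ScalarField) : Prop :=
  X.reeb.Isomorphic Y.reeb

/-! ### Reeb graphs as multigraphs

In this part `R` is a Reeb graph, regarded as a one-dimensional scalar field. -/

/-- The vertices (critical points) of a Reeb graph: the points near which the function is not a
local coordinate, that is, those without an open neighbourhood mapped homeomorphically onto an open
subset of the line. -/
def vertices (R : ScalarField) : Set R.carrier :=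
  {x | ¬ ∃ U : Set R.carrier, IsOpen U ∧ x ∈ U ∧
    Topology.IsOpenEmbedding (fun y : U => R.toFun y)}

/-- The critical values of a Reeb graph. -/
def criticalValues (R : ScalarField) : Set ℝ := R.toFun '' R.vertices

/-- The multigraph underlying a Reeb graph `R`. Its edges are the connected components of the
complement of the vertices, and an edge joins the vertices in its closure. -/
def multigraph (R : ScalarField) : Graph R.carrier (Set R.carrier) where
  vertexSet := R.vertices
  IsLink e x y := (∃ p ∈ R.verticesᶜ, e = connectedComponentIn R.verticesᶜ p) ∧
    closure e ∩ R.vertices = {x, y}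
  isLink_symm _ _ := ⟨fun x y h => ⟨h.1, by rw [h.2, Set.pair_comm]⟩⟩
  eq_or_eq_of_isLink_of_isLink e x y v w h h' := by
    have hx : x ∈ ({v, w} : Set R.carrier) := by rw [← h'.2, h.2]; simp
    simpa using hx
  left_mem_of_isLink e x y h := by
    have hx : x ∈ closure e ∩ R.vertices := by rw [h.2]; simp
    exact hx.2

end ScalarField

/-- Isomorphism of multigraphs: bijections of the vertices and of the edges that respect
incidence. -/
def Graph.Isomorphic {α β α' β' : Type*} (G : Graph α β) (H : Graph α' β') : Prop :=
  ∃ (φ : G.vertexSet ≃ H.vertexSet) (ψ : G.edgeSet ≃ H.edgeSet),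
    ∀ (e : G.edgeSet) (v w : G.vertexSet),
      G.IsLink e v w ↔ H.IsLink (ψ e) (φ v) (φ w)

/-! ### Relative singular homology of pairs of subsets -/

/-- A pair `(A, B)` of subsets of `T` with `B ⊆ A`. -/
structure SetPair (T : Type) where
  big : Set T
  small : Set T
  small_subset : small ⊆ big

namespace SetPair

variable {T : Type}

instance : LE (SetPair T) := ⟨fun P Q => P.big ⊆ Q.big ∧ P.small ⊆ Q.small⟩

theorem le_trans' {P Q S : SetPair T} (h : P ≤ Q) (h' : Q ≤ S) : P ≤ S :=
  ⟨h.1.trans h'.1, h.2.trans h'.2⟩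

end SetPair

section Homology

open CategoryTheory

variable (k : Type u) [Field k] {T : Type} [TopologicalSpace T]

/-- The singular chain complex with coefficients in `k` of a subset of `T`. -/
abbrev subsetChains (A : Set T) : ChainComplex (ModuleCat.{u} k) ℕ :=
  ((AlgebraicTopology.singularChainComplexFunctor (ModuleCat.{u} k)).obj (ModuleCat.of k k)).obj
    (TopCat.of A)

/-- The chain map induced by an inclusion of subsets of `T`. -/
abbrev subsetChainsMap {A B : Set T} (h : A ⊆ B) : subsetChains k A ⟶ subsetChains k B :=
  ((AlgebraicTopology.singularChainComplexFunctor (ModuleCat.{u} k)).obj (ModuleCat.of k k)).map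
    (TopCat.ofHom ⟨Set.inclusion h, continuous_inclusion h⟩)

theorem subsetChainsMap_comp {A B C : Set T} (h : A ⊆ B) (h' : B ⊆ C) :
    subsetChainsMap k h ≫ subsetChainsMap k h' = subsetChainsMap k (h.trans h') := by
  rw [← Functor.map_comp]
  rfl

/-- The relative singular chain complex of a pair. -/
abbrev relChains (P : SetPair T) : ChainComplex (ModuleCat.{u} k) ℕ :=
  Limits.cokernel (subsetChainsMap k P.small_subset)

/-- The chain map induced by an inclusion of pairs. -/
abbrev relChainsMap {P Q : SetPair T} (h : P ≤ Q) : relChains k P ⟶ relChains k Q :=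
  Limits.cokernel.map _ _ (subsetChainsMap k h.2) (subsetChainsMap k h.1)
    (by rw [subsetChainsMap_comp, subsetChainsMap_comp])

/-- The `d`-th relative singular homology of a pair; for `P = (A, ∅)` this is the homology
of `A`. -/
abbrev relHomology (d : ℕ) (P : SetPair T) : ModuleCat.{u} k :=
  (relChains k P).homology d

/-- The linear map on relative homology induced by an inclusion of pairs. -/
abbrev relHomologyMap (d : ℕ) {P Q : SetPair T} (h : P ≤ Q) :
    relHomology k d P →ₗ[k] relHomology k d Q :=
  (HomologicalComplex.homologyMap (relChainsMap k h) d).hom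

/-- For `P ≤ P' ≤ Q`, the classes of `P'` whose image in the homology of `Q` lies in the image of
the homology of `P`. A class born at `P'` (coming from `P`) is dead at `Q` if and only if it lies
in this subspace. -/
def deadClasses (d : ℕ) {P P' Q : SetPair T} (h : P ≤ P') (h' : P' ≤ Q) :
    Submodule k (relHomology k d P') :=
  (LinearMap.range (relHomologyMap k d (SetPair.le_trans' h h'))).comap (relHomologyMap k d h')

/-- For `P ≤ P' ≤ Q ≤ Q'`, the number of independent classes that are born when passing from
`P` to `P'` and die when passing from `Q` to `Q'`. -/
def bornDying (d : ℕ) {P P' Q Q' : SetPair T} (h : P ≤ P') (h' : P' ≤ Q) (h'' : Q ≤ Q') : ℕ :=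
  Module.finrank k (deadClasses k d h (SetPair.le_trans' h' h'') ⧸
    (deadClasses k d h h').submoduleOf (deadClasses k d h (SetPair.le_trans' h' h'')))

end Homology

/-! ### Regular values interleaved with the critical values -/

open Classical in
/-- For `s` in a finite set `C`, a number between `s` and the next element of `C`
(`s + 1` if there is none). -/
def upperGap (C : Set ℝ) (s : ℝ) : ℝ :=
  if (C ∩ Set.Ioi s).Nonempty then (s + sInf (C ∩ Set.Ioi s)) / 2 else s + 1

open Classical in
/-- For `s` in a finite set `C`, a number between the previous element of `C` and `s`
(`s - 1` if there is none). -/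
def lowerGap (C : Set ℝ) (s : ℝ) : ℝ :=
  if (C ∩ Set.Iio s).Nonempty then (sSup (C ∩ Set.Iio s) + s) / 2 else s - 1

theorem le_upperGap (C : Set ℝ) (s : ℝ) : s ≤ upperGap C s := by
  unfold upperGap
  split_ifs with h
  · have : s ≤ sInf (C ∩ Set.Ioi s) := le_csInf h fun b hb => hb.2.le
    linarith
  · linarith

theorem lowerGap_le (C : Set ℝ) (s : ℝ) : lowerGap C s ≤ s := by
  unfold lowerGap
  split_ifs with h
  · have : sSup (C ∩ Set.Iio s) ≤ s := csSup_le h fun b hb => hb.2.le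
    linarith
  · linarith

theorem lowerGap_le_upperGap (C : Set ℝ) (s : ℝ) : lowerGap C s ≤ upperGap C s :=
  (lowerGap_le C s).trans (le_upperGap C s)

theorem upperGap_le_lowerGap {C : Set ℝ} {s t : ℝ} (hs : s ∈ C) (ht : t ∈ C) (h : s < t) :
    upperGap C s ≤ lowerGap C t := by
  have h1 : sInf (C ∩ Set.Ioi s) ≤ t := csInf_le ⟨s, fun b hb => hb.2.le⟩ ⟨ht, h⟩
  have h2 : s ≤ sSup (C ∩ Set.Iio t) := le_csSup ⟨t, fun b hb => hb.2.le⟩ ⟨hs, h⟩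
  rw [upperGap, lowerGap, if_pos ⟨t, ht, h⟩, if_pos ⟨s, hs, h⟩]
  linarith

/-! ### Extended persistence diagrams -/

/-- The classes of points of an extended persistence diagram: ordinary, relative, extended. -/
inductive PairClass
  | ord
  | rel
  | ext

namespace ScalarField

variable (R : ScalarField)

/-- The pair `(R_a, ∅)`, where `R_a` is the sublevel set at `a`. -/
def sub (a : ℝ) : SetPair R.carrier := ⟨R.toFun ⁻¹' Set.Iic a, ∅, Set.empty_subset _⟩

/-- The pair `(R, R^a)`, where `R^a` is the superlevel set at `a`. -/
def sup (a : ℝ) : SetPair R.carrier := ⟨Set.univ, R.toFun ⁻¹' Set.Ici a, Set.subset_univ _⟩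

theorem sub_le_sub {a b : ℝ} (h : a ≤ b) : R.sub a ≤ R.sub b :=
  ⟨Set.preimage_mono (Set.Iic_subset_Iic.2 h), subset_rfl⟩

theorem sup_le_sup {a b : ℝ} (h : b ≤ a) : R.sup a ≤ R.sup b :=
  ⟨subset_rfl, Set.preimage_mono (Set.Ici_subset_Ici.2 h)⟩

theorem sub_le_sup (a b : ℝ) : R.sub a ≤ R.sup b :=
  ⟨Set.subset_univ _, Set.empty_subset _⟩

variable (k : Type u) [Field k]

open Classical in
/-- The multiplicity of the point `(s, t)` in the class `c` of the `d`-th extended persistence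
diagram of a Reeb graph `R`: the number of independent classes in the extended filtration
`H_d(R_a)` (`a` increasing) followed by `H_d(R, R^a)` (`a` decreasing) that are born when `a`
passes the critical value `s` and die when `a` passes the critical value `t`. -/
def exDgm (d : ℕ) (c : PairClass) (p : ℝ × ℝ) : ℕ :=
  if hC : p.1 ∈ R.criticalValues ∧ p.2 ∈ R.criticalValues then
    match c with
    | .ord =>
      if h : p.1 < p.2 then
        bornDying k d (R.sub_le_sub (lowerGap_le_upperGap _ p.1))
          (R.sub_le_sub (upperGap_le_lowerGap hC.1 hC.2 h))
          (R.sub_le_sub (lowerGap_le_upperGap _ p.2))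
      else 0
    | .rel =>
      if h : p.2 < p.1 then
        bornDying k d (R.sup_le_sup (lowerGap_le_upperGap _ p.1))
          (R.sup_le_sup (upperGap_le_lowerGap hC.2 hC.1 h))
          (R.sup_le_sup (lowerGap_le_upperGap _ p.2))
      else 0
    | .ext =>
        bornDying k d (R.sub_le_sub (lowerGap_le_upperGap _ p.1))
          (R.sub_le_sup (upperGap R.criticalValues p.1) (upperGap R.criticalValues p.2))
          (R.sup_le_sup (lowerGap_le_upperGap _ p.2))
  else 0

/-- The points of one subdiagram, each repeated according to its multiplicity. -/
abbrev SubPoint (d : ℕ) (c : PairClass) : Type := Σ p : ℝ × ℝ, Fin (R.exDgm k d c p)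

/-- The points of the full extended persistence diagram (the union over all dimensions and
classes), each repeated according to its multiplicity. -/
abbrev FullPoint : Type := Σ (d : ℕ) (c : PairClass), R.SubPoint k d c

/-- The position in the plane of a point of a subdiagram. -/
def subPos {d : ℕ} {c : PairClass} (x : R.SubPoint k d c) : ℝ × ℝ := x.1

/-- The position in the plane of a point of the full diagram. -/
def fullPos (x : R.FullPoint k) : ℝ × ℝ := x.2.2.1

/-- A Reeb graph is generic if distinct critical points have distinct function values and no
critical value is a coordinate of two points of the full extended persistence diagram. -/
def IsGeneric : Prop :=
  Set.InjOn R.toFun R.vertices ∧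
  ∀ x y : R.FullPoint k,
    ((R.fullPos k x).1 = (R.fullPos k y).1 ∨ (R.fullPos k x).1 = (R.fullPos k y).2 ∨
      (R.fullPos k x).2 = (R.fullPos k y).2) → x = y

end ScalarField

/-! ### Bottleneck distances -/

/-- A matching between two diagrams, given as families of points in the plane: a bijection between
sets of off-diagonal points of the two diagrams. -/
structure DiagramMatching {ι κ : Type} (P : ι → ℝ × ℝ) (Q : κ → ℝ × ℝ) where
  source : Set ι
  target : Set κ
  source_offDiag : ∀ i ∈ source, (P i).1 ≠ (P i).2
  target_offDiag : ∀ j ∈ target, (Q j).1 ≠ (Q j).2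
  toEquiv : source ≃ target

/-- The cost of leaving a point unmatched: half the difference of its coordinates. -/
def diagCost (p : ℝ × ℝ) : ℝ≥0∞ := ENNReal.ofReal (|p.1 - p.2| / 2)

/-- The cost of a matching: the supremum of the `ℓ^∞` distances of the matched points and of the
costs of the unmatched points. -/
def DiagramMatching.cost {ι κ : Type} {P : ι → ℝ × ℝ} {Q : κ → ℝ × ℝ}
    (M : DiagramMatching P Q) : ℝ≥0∞ :=
  max (⨆ i : M.source, edist (P i) (Q (M.toEquiv i)))
    (max (⨆ i ∈ M.sourceᶜ, diagCost (P i)) (⨆ j ∈ M.targetᶜ, diagCost (Q j)))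

/-- The (ungraded) bottleneck distance between two diagrams. -/
def bottleneck {ι κ : Type} (P : ι → ℝ × ℝ) (Q : κ → ℝ × ℝ) : ℝ≥0∞ :=
  ⨅ M : DiagramMatching P Q, M.cost

namespace ScalarField

variable (k : Type u) [Field k]

/-- The ungraded bottleneck distance between the Reeb graphs of two scalar fields. -/
def ungradedBottleneck (X Y : ScalarField) : ℝ≥0∞ :=
  bottleneck (X.reeb.fullPos k) (Y.reeb.fullPos k)

/-- The bottleneck distance between two subdiagrams of the same type. -/
def typeBottleneck (d : ℕ) (c : PairClass) (X Y : ScalarField) : ℝ≥0∞ :=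
  bottleneck (X.reeb.subPos k (d := d) (c := c)) (Y.reeb.subPos k (d := d) (c := c))

/-- The graded bottleneck distance between the Reeb graphs of two scalar fields: the maximum over
the four types of points that occur for Reeb graphs. -/
def gradedBottleneck (X Y : ScalarField) : ℝ≥0∞ :=
  max (max (typeBottleneck k 0 .ext X Y) (typeBottleneck k 1 .ext X Y))
    (max (typeBottleneck k 1 .rel X Y) (typeBottleneck k 0 .ord X Y))

/-- The scalar fields under consideration: constructible, on a path-connected space, with generic
Reeb graph. -/
def IsAdmissible (X : ScalarField) : Prop :=
  X.IsConstructible ∧ PathConnectedSpace X.carrier ∧ X.reeb.IsGeneric k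

/-- A distance between Reeb graphs (of the scalar fields satisfying `A`) is isomorphism invariant
if it vanishes exactly on the pairs of isomorphic Reeb graphs. -/
def IsIsomorphismInvariant (A : ScalarField → Prop)
    (dist : ScalarField → ScalarField → ℝ≥0∞) : Prop :=
  ∀ X Y : ScalarField, A X → A Y → (dist X Y = 0 ↔ X.ReebIsomorphic Y)

end ScalarField

end

/-! The extended persistence diagram records at which heights components merge, but by the elder
rule not which branches merge. Consider two trees with leaves at heights 0, 1, 2 and root at height
5. In the first, the branch of leaf 2 joins that of leaf 0 at height 3, and leaf 1 joins them at
height 4. In the second, leaf 2 joins the branch of leaf 1 at height 3, and leaf 0 joins them at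
height 4. In both, the class of leaf 2 dies at 3, the younger of the other two leaves dies at 4, and
leaf 0 is paired with the maximum. So both diagrams consist of the ordinary points (2, 3), (1, 4)
and the extended point (0, 5), all in dimension 0. The underlying graphs agree as well. But a
height-preserving homeomorphism respects the component of the lowest point below height 4, and at
height 5/2 this component has two points in the first tree and one in the second
(`PlanarTree.not_isomorphic`).

The structure `ThreeLeafTree` leaves open which older leaf absorbs leaf 2; together with the
critical values it still determines the diagram (`ThreeLeafTree.exDgm_eq`). The upward flow `push`
deforms every sublevel set into a finite level set, so that only degree 0 survives, and it retracts
the tree onto each superlevel set at height at most 5, so that the relative homology vanishes there.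
In degree 0 the homology is spanned by points, joined points have equal classes, and functionals
detect single path components; `bornDying_zero_eq_one` is the resulting form of the elder rule.

Level sets are finite, so each tree is its own Reeb graph (`ThreeLeafTree.isomorphic_reeb`) and all
structure can be transported to the Reeb graph. The vertices and edges are read off from an
`EdgeModel`, whose multigraph depends on the incidences alone and not on the heights. -/

/-! ### Singular homology of pairs: point classes, path components, vanishing criteria -/

section RelativeHomology

open CategoryTheory Limits AlgebraicTopology Simplicial

variable (k : Type u) [Field k] {T : Type} [TopologicalSpace T]

/-- The projection from the singular chains of the big set to the relative chains. -/
noncomputable def relProj (P : SetPair T) : subsetChains k P.big ⟶ relChains k P :=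
  cokernel.π _

instance (P : SetPair T) : Epi (relProj k P) := by unfold relProj; infer_instance

instance (P : SetPair T) : Epi ((relProj k P).f 0) :=
  inferInstanceAs (Epi ((HomologicalComplex.eval _ _ 0).map (relProj k P)))

theorem relProj_relChainsMap {P Q : SetPair T} (h : P ≤ Q) :
    relProj k P ≫ relChainsMap k h = subsetChainsMap k h.1 ≫ relProj k Q := by
  simp [relProj]

/-- The singular `0`-chain given by a point. -/
noncomputable def pointChain (A : Set T) (x : A) : ModuleCat.of k k ⟶ (subsetChains k A).X 0 :=
  SSet.ιChainComplex (TopCat.toSSet.obj (TopCat.of A))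
    (R := ModuleCat.of k k) (n := 0) (TopCat.toSSetObj₀Equiv.symm x)

theorem pointChain_map {A B : Set T} (h : A ⊆ B) (x : A) :
    pointChain k A x ≫ (subsetChainsMap k h).f 0 = pointChain k B (Set.inclusion h x) :=
  SSet.ι_chainComplexMap_f _ _ (TopCat.toSSet.map
    (TopCat.ofHom ⟨Set.inclusion h, continuous_inclusion h⟩)) _ _

theorem subsetChains_hom_ext {A : Set T} {M : ModuleCat.{u} k}
    {φ ψ : (subsetChains k A).X 0 ⟶ M}
    (h : ∀ x : A, pointChain k A x ≫ φ = pointChain k A x ≫ ψ) : φ = ψ := by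
  refine SSet.chainComplex_hom_ext (X := TopCat.toSSet.obj (TopCat.of A)) fun x => ?_
  obtain ⟨y, rfl⟩ := TopCat.toSSetObj₀Equiv.symm.surjective x
  exact h y

theorem TopCat.ιChainComplex_sub_eq_boundary {X : TopCat.{0}} (M : ModuleCat.{u} k) {x y : X}
    (γ : X.Path x y) :
    SSet.ιChainComplex (TopCat.toSSet.obj X) (R := M) (n := 0) (TopCat.toSSetObj₀Equiv.symm y) -
      SSet.ιChainComplex (TopCat.toSSet.obj X) (TopCat.toSSetObj₀Equiv.symm x) =
    SSet.ιChainComplex (TopCat.toSSet.obj X) (TopCat.toSSetObj₁Equiv.symm γ.hom) ≫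
      ((TopCat.toSSet.obj X).chainComplex M).d 1 0 := by
  have := SSet.ιChainComplex_d (TopCat.toSSet.obj X) M (TopCat.toSSetObj₁Equiv.symm γ.hom)
  rw [this, Fin.sum_univ_two]
  simp [sub_eq_add_neg]

theorem pointChain_sub_eq_boundary {A : Set T} {x y : A} (γ : Path x y) :
    ∃ e : ModuleCat.of k k ⟶ (subsetChains k A).X 1,
      pointChain k A y - pointChain k A x = e ≫ (subsetChains k A).d 1 0 :=
  ⟨_, TopCat.ιChainComplex_sub_eq_boundary k _ (X := TopCat.of A) (TopCat.pathEquiv.symm γ)⟩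

/-- The degree zero relative homology class of a point. -/
noncomputable def pointHom (P : SetPair T) (x : P.big) :
    ModuleCat.of k k ⟶ relHomology k 0 P :=
  (relChains k P).liftCycles (pointChain k P.big x ≫ (relProj k P).f 0) 0 (by simp) (by simp) ≫
    (relChains k P).homologyπ 0

/-- In degree 0 every chain is a cycle, so the homology is a quotient of the relative chains, hence
of the chains of the big set, which are generated by points. -/
theorem relHomology_hom_ext {P : SetPair T} {M : ModuleCat.{u} k}
    {φ ψ : relHomology k 0 P ⟶ M}
    (h : ∀ x : P.big, pointHom k P x ≫ φ = pointHom k P x ≫ ψ) : φ = ψ := by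
  have hi : IsIso ((relChains k P).iCycles 0) :=
    HomologicalComplex.isIso_iCycles _ _ 0 (by simp) (by simp)
  rw [← cancel_epi ((relChains k P).homologyπ 0), ← cancel_epi (inv ((relChains k P).iCycles 0)),
    ← cancel_epi ((relProj k P).f 0)]
  refine subsetChains_hom_ext k fun x => ?_
  have e : pointHom k P x = pointChain k P.big x ≫ (relProj k P).f 0 ≫
      inv ((relChains k P).iCycles 0) ≫ (relChains k P).homologyπ 0 := by
    have : (relChains k P).liftCycles (pointChain k P.big x ≫ (relProj k P).f 0) 0
        (by simp) (by simp) = pointChain k P.big x ≫ (relProj k P).f 0 ≫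
      inv ((relChains k P).iCycles 0) := by
      rw [← Category.assoc, IsIso.eq_comp_inv]
      simp
    rw [pointHom, this]
    simp
  simpa [e] using h x

theorem pointHom_map {P Q : SetPair T} (h : P ≤ Q) (x : P.big) :
    pointHom k P x ≫ HomologicalComplex.homologyMap (relChainsMap k h) 0 =
      pointHom k Q (Set.inclusion h.1 x) := by
  have := congrArg (fun f => f.f 0) (relProj_relChainsMap k h)
  simp only [HomologicalComplex.comp_f] at this
  simp only [pointHom, Category.assoc, HomologicalComplex.homologyπ_naturality,
    HomologicalComplex.liftCycles_comp_cyclesMap_assoc]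
  congr 2
  rw [this, ← pointChain_map k h.1, Category.assoc]

/-- A path is a singular 1-simplex whose boundary is the difference of its endpoints. -/
theorem pointHom_eq_of_joined {P : SetPair T} {x y : P.big} (h : Joined x y) :
    pointHom k P x = pointHom k P y := by
  obtain ⟨γ⟩ := h
  obtain ⟨e, he⟩ := pointChain_sub_eq_boundary k γ
  have hb := (relChains k P).liftCycles_homologyπ_eq_zero_of_boundary
    (k := (pointChain k P.big y - pointChain k P.big x) ≫ (relProj k P).f 0) (i := 0)
    0 (by simp) (i' := 1) (e ≫ (relProj k P).f 1) (by rw [he]; simp)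
  rw [eq_comm, ← sub_eq_zero, ← hb, pointHom, pointHom, ← Preadditive.sub_comp]
  congr 1
  rw [← cancel_mono ((relChains k P).iCycles 0)]
  simp [Preadditive.sub_comp]

/-- The degree zero relative homology class of a point. -/
noncomputable def pointClass (P : SetPair T) (x : P.big) : relHomology k 0 P :=
  (pointHom k P x).hom (1 : k)

theorem relHomologyMap_pointClass {P Q : SetPair T} (h : P ≤ Q) (x : P.big) :
    relHomologyMap k 0 h (pointClass k P x) = pointClass k Q (Set.inclusion h.1 x) :=
  congrArg (fun f => f.hom (1 : k)) (pointHom_map k h x)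

theorem pointClass_eq_of_joined {P : SetPair T} {x y : P.big} (h : Joined x y) :
    pointClass k P x = pointClass k P y := by
  rw [pointClass, pointClass, pointHom_eq_of_joined k h]

theorem span_pointClass (P : SetPair T) :
    Submodule.span k (Set.range (pointClass k P)) = ⊤ := by
  -- The quotient map by the span kills all point classes, and morphisms out of degree 0 homology
  -- are determined on these.
  have h : ModuleCat.ofHom (Submodule.span k (Set.range (pointClass k P))).mkQ = 0 := by
    refine relHomology_hom_ext k fun x => ModuleCat.hom_ext (LinearMap.ext_ring ?_)
    have hx : pointClass k P x ∈ Submodule.span k (Set.range (pointClass k P)) :=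
      Submodule.subset_span ⟨x, rfl⟩
    simpa [pointClass] using hx
  rw [← Submodule.ker_mkQ (Submodule.span k (Set.range (pointClass k P))), LinearMap.ker_eq_top]
  simpa using congrArg (fun f => f.hom) h

theorem span_pointClass_of_joined {P : SetPair T} (S : Set P.big)
    (h : ∀ x : P.big, ∃ y ∈ S, Joined x y) :
    Submodule.span k (pointClass k P '' S) = ⊤ := by
  rw [eq_top_iff, ← span_pointClass]
  refine Submodule.span_mono ?_
  rintro _ ⟨x, rfl⟩
  obtain ⟨y, hy, hxy⟩ := h x
  exact ⟨y, hy, (pointClass_eq_of_joined k hxy).symm⟩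

theorem subsetChainsMap_empty {B A : Set T} (h : B ⊆ A) (hB : B = ∅) :
    subsetChainsMap k h = 0 := by
  subst hB
  ext n : 1
  refine SSet.chainComplex_hom_ext (X := TopCat.toSSet.obj (TopCat.of (∅ : Set T))) fun x => ?_
  exact isEmptyElim (TopCat.toSSetObjEquiv (TopCat.of (∅ : Set T)) _ x (Classical.arbitrary _))

theorem isIso_relProj {P : SetPair T} (hP : P.small = ∅) : IsIso (relProj k P) := by
  have h0 := subsetChainsMap_empty k P.small_subset hP
  refine ⟨cokernel.desc _ (𝟙 _) (by rw [h0, zero_comp]), by simp [relProj], ?_⟩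
  rw [← cancel_epi (relProj k P)]
  simp [relProj]

theorem pointHom_eq (P : SetPair T) (x : P.big) :
    pointHom k P x =
      (subsetChains k P.big).liftCycles (pointChain k P.big x) 0 (by simp) (by simp) ≫
      (subsetChains k P.big).homologyπ 0 ≫ HomologicalComplex.homologyMap (relProj k P) 0 := by
  simp [pointHom]

-- Without a small set, degree 0 homology is the direct sum of copies of `k` over the path
-- components; the functional is the projection to the summand of `z`.
open Classical in
theorem exists_functional {P : SetPair T} (hP : P.small = ∅) (z : P.big) :
    ∃ φ : relHomology k 0 P →ₗ[k] k, ∀ x, φ (pointClass k P x) = if Joined x z then 1 else 0 := by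
  have := isIso_relProj k hP
  let X := TopCat.toSSet.obj (TopCat.of P.big)
  let σ : (∐ fun _ : X.π₀ => ModuleCat.of k k) ⟶ ModuleCat.of k k :=
    Sigma.desc fun c => if c = SSet.π₀.mk (TopCat.toSSetObj₀Equiv.symm z) then 𝟙 _ else 0
  let ρ : (subsetChains k P.big).homology 0 ⟶ ∐ fun _ : X.π₀ => ModuleCat.of k k :=
    (SSet.homology₀Iso X (ModuleCat.of k k)).hom
  let ψ : relHomology k 0 P ⟶ ModuleCat.of k k :=
    inv (HomologicalComplex.homologyMap (relProj k P) 0) ≫ ρ ≫ σ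
  have key (x : P.big) : pointHom k P x ≫ ψ = if Joined x z then 𝟙 _ else 0 := by
    have e := SSet.liftCycles_ιChainComplex_homologyπ_homology₀Iso_hom X (ModuleCat.of k k)
      (TopCat.toSSetObj₀Equiv.symm x)
    have e' : (subsetChains k P.big).liftCycles (pointChain k P.big x) 0 (by simp) (by simp) ≫
      (subsetChains k P.big).homologyπ 0 ≫ ρ = Sigma.ι (fun _ : X.π₀ => ModuleCat.of k k)
        (SSet.π₀.mk (TopCat.toSSetObj₀Equiv.symm x)) := e
    have hj : SSet.π₀.mk (TopCat.toSSetObj₀Equiv.symm x) =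
        (SSet.π₀.mk (TopCat.toSSetObj₀Equiv.symm z) : X.π₀) ↔ Joined x z := by
      rw [← TopCat.zerothHomotopyEquiv_mk, ← TopCat.zerothHomotopyEquiv_mk,
        EmbeddingLike.apply_eq_iff_eq]
      exact Quotient.eq (r := pathSetoid _)
    rw [pointHom_eq]
    simp only [ψ, Category.assoc, IsIso.hom_inv_id_assoc]
    rw [reassoc_of% e', Sigma.ι_desc]
    simp only [hj]
  refine ⟨ψ.hom, fun x => ?_⟩
  have := congrArg (fun f => f.hom (1 : k)) (key x)
  refine Eq.trans this ?_
  split_ifs <;> rfl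

-- The identity of the big set factors up to homotopy through a totally disconnected space, which
-- has no homology in positive degrees. So the identity of the homology factors through zero.
-- Nothing is required of the composite in the other order.
open HomologicalComplex in
theorem subsingleton_relHomology_of_homotopy_discrete {P : SetPair T} (hP : P.small = ∅)
    {F : Set T} (hF : F ⊆ P.big) [TotallyDisconnectedSpace F] (r : C(P.big, F))
    (H : ContinuousMap.Homotopy (ContinuousMap.id P.big)
      ((⟨Set.inclusion hF, continuous_inclusion hF⟩ : C(F, P.big)).comp r))
    {d : ℕ} (hd : d ≠ 0) : Subsingleton (relHomology k d P) := by
  have := isIso_relProj k hP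
  apply ModuleCat.subsingleton_of_isZero
  refine IsZero.of_iso ?_ (asIso (homologyMap (relProj k P) d)).symm
  have hz : IsZero ((subsetChains k F).homology d) :=
    (singularChainComplexFunctor_exactAt_of_totallyDisconnectedSpace (ModuleCat.{u} k) d
      (ModuleCat.of k k) (TopCat.of F) hd).isZero_homology
  let r' : TopCat.of P.big ⟶ TopCat.of F := TopCat.ofHom r
  let i' : TopCat.of F ⟶ TopCat.of P.big :=
    TopCat.ofHom ⟨Set.inclusion hF, continuous_inclusion hF⟩
  have H' : TopCat.Homotopy (𝟙 (TopCat.of P.big)) (r' ≫ i') := H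
  have := H'.congr_homologyMap_singularChainComplexFunctor (ModuleCat.of k k) d
  rw [CategoryTheory.Functor.map_id, homologyMap_id, Functor.map_comp, homologyMap_comp] at this
  rw [IsZero.iff_id_eq_zero]
  refine this.trans ?_
  rw [hz.eq_of_tgt (homologyMap
    (((singularChainComplexFunctor (ModuleCat.{u} k)).obj (ModuleCat.of k k)).map r') d) 0,
    zero_comp]

-- The retraction splits the cokernel off as the direct summand of `A` cut out by the idempotent `𝟙
-- - r ≫ i`. This idempotent vanishes on homology, so the summand has none; no long exact sequence
-- is needed.
open HomologicalComplex in
theorem isZero_homology_cokernel_of_retract {A B : ChainComplex (ModuleCat.{u} k) ℕ}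
    (i : B ⟶ A) (r : A ⟶ B) (hir : i ≫ r = 𝟙 B) (d : ℕ)
    (hh : homologyMap (r ≫ i) d = 𝟙 _) : IsZero ((cokernel i).homology d) := by
  let s : cokernel i ⟶ A := cokernel.desc _ (𝟙 _ - r ≫ i) (by
    rw [Preadditive.comp_sub, reassoc_of% hir, Category.comp_id, sub_self])
  have hps : cokernel.π i ≫ s = 𝟙 _ - r ≫ i := cokernel.π_desc _ _ _
  have hsp : s ≫ cokernel.π i = 𝟙 _ := by
    rw [← cancel_epi (cokernel.π i), reassoc_of% hps, Preadditive.sub_comp, Category.assoc,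
      cokernel.condition]
    simp
  have hps0 : homologyMap (cokernel.π i) d ≫ homologyMap s d = 0 := by
    rw [← homologyMap_comp, hps, homologyMap_sub, sub_eq_zero, hh, homologyMap_id]
  have hsp1 : homologyMap s d ≫ homologyMap (cokernel.π i) d = 𝟙 _ := by
    rw [← homologyMap_comp, hsp, homologyMap_id]
  rw [IsZero.iff_id_eq_zero]
  calc 𝟙 _ = (homologyMap s d ≫ homologyMap (cokernel.π i) d) ≫
        (homologyMap s d ≫ homologyMap (cokernel.π i) d) := by rw [hsp1, Category.comp_id]
    _ = homologyMap s d ≫ (homologyMap (cokernel.π i) d ≫ homologyMap s d) ≫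
        homologyMap (cokernel.π i) d := by simp only [Category.assoc]
    _ = 0 := by rw [hps0, zero_comp, comp_zero]

open HomologicalComplex in
theorem subsingleton_relHomology_of_retract {P : SetPair T} (r : C(P.big, P.small))
    (hr : ∀ x, r (Set.inclusion P.small_subset x) = x)
    (H : ContinuousMap.Homotopy (ContinuousMap.id P.big)
      ((⟨Set.inclusion P.small_subset, continuous_inclusion P.small_subset⟩ :
        C(P.small, P.big)).comp r))
    (d : ℕ) : Subsingleton (relHomology k d P) := by
  apply ModuleCat.subsingleton_of_isZero
  let r' : TopCat.of P.big ⟶ TopCat.of P.small := TopCat.ofHom r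
  let i' : TopCat.of P.small ⟶ TopCat.of P.big :=
    TopCat.ofHom ⟨Set.inclusion P.small_subset, continuous_inclusion P.small_subset⟩
  have hir : i' ≫ r' = 𝟙 _ := by ext x; exact congrArg Subtype.val (hr x)
  have H' : TopCat.Homotopy (𝟙 (TopCat.of P.big)) (r' ≫ i') := H
  have h1 : subsetChainsMap k P.small_subset ≫
      ((singularChainComplexFunctor (ModuleCat.{u} k)).obj (ModuleCat.of k k)).map r' = 𝟙 _ := by
    rw [← CategoryTheory.Functor.map_id, ← hir, Functor.map_comp]
  have h2 : homologyMap
      (((singularChainComplexFunctor (ModuleCat.{u} k)).obj (ModuleCat.of k k)).map r' ≫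
        subsetChainsMap k P.small_subset) d = 𝟙 _ := by
    have hh := H'.congr_homologyMap_singularChainComplexFunctor (ModuleCat.of k k) d
    rw [CategoryTheory.Functor.map_id, homologyMap_id, Functor.map_comp] at hh
    exact hh.symm
  exact isZero_homology_cokernel_of_retract k _ _ h1 d h2

end RelativeHomology

/-! ### Criteria for the number of classes born and dying -/

section BornDying

open CategoryTheory

variable (k : Type u) [Field k] {T : Type} [TopologicalSpace T] {d : ℕ}
  {P P' Q Q' : SetPair T} (h : P ≤ P') (h' : P' ≤ Q) (h'' : Q ≤ Q')

theorem relHomologyMap_comp_apply {P Q S : SetPair T} (h : P ≤ Q) (h' : Q ≤ S)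
    (x : relHomology k d P) :
    relHomologyMap k d h' (relHomologyMap k d h x) =
      relHomologyMap k d (SetPair.le_trans' h h') x := by
  have : relChainsMap k h ≫ relChainsMap k h' = relChainsMap k (SetPair.le_trans' h h') := by
    rw [← cancel_epi (relProj k P), reassoc_of% relProj_relChainsMap k h,
      relProj_relChainsMap, relProj_relChainsMap, ← Category.assoc, subsetChainsMap_comp]
  simp only [relHomologyMap, ← this, HomologicalComplex.homologyMap_comp]
  rfl

theorem bornDying_eq_zero_of_le
    (hle : deadClasses k d h (SetPair.le_trans' h' h'') ≤ deadClasses k d h h') :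
    bornDying k d h h' h'' = 0 := by
  rw [bornDying, Submodule.submoduleOf_eq_top.2 hle]
  have : Subsingleton (deadClasses k d h (SetPair.le_trans' h' h'') ⧸
    (⊤ : Submodule k (deadClasses k d h (SetPair.le_trans' h' h'')))) :=
    Submodule.Quotient.subsingleton_iff.2 rfl
  exact Module.finrank_zero_of_subsingleton

theorem bornDying_eq_zero_of_subsingleton [Subsingleton (relHomology k d P')] :
    bornDying k d h h' h'' = 0 :=
  bornDying_eq_zero_of_le k h h' h'' fun x _ => by
    rw [Subsingleton.elim x 0]; exact zero_mem _

/-- Every class is already dead at `Q`, so none is left to die between `Q` and `Q'`. -/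
theorem bornDying_eq_zero_of_surjective
    (hs : Function.Surjective (relHomologyMap k d (SetPair.le_trans' h h'))) :
    bornDying k d h h' h'' = 0 :=
  bornDying_eq_zero_of_le k h h' h'' fun _ _ => hs _

/-- A class of `P'` that meets the image of `P` in `Q'` already came from `P`, so it was never born.
-/
theorem bornDying_eq_zero_of_injective
    (hi : Function.Injective (relHomologyMap k d (SetPair.le_trans' h' h''))) :
    bornDying k d h h' h'' = 0 := by
  refine bornDying_eq_zero_of_le k h h' h'' fun x ⟨y, hy⟩ => ⟨y, ?_⟩
  have : relHomologyMap k d h y = x := by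
    apply hi
    rw [relHomologyMap_comp_apply, hy]
  rw [← this, relHomologyMap_comp_apply]

/-- Modulo old classes `z` is the only generator, so the count is at most one; `φ` kills the old
classes but not `z`, so `z` is alive at `Q` and the count is not zero. -/
theorem bornDying_eq_one (z : relHomology k d P')
    (hspan : Submodule.span k {z} ⊔ LinearMap.range (relHomologyMap k d h) = ⊤)
    (φ : relHomology k d Q →ₗ[k] k)
    (hφ : ∀ y, φ (relHomologyMap k d (SetPair.le_trans' h h') y) = 0)
    (hz : φ (relHomologyMap k d h' z) ≠ 0)
    (hd : z ∈ deadClasses k d h (SetPair.le_trans' h' h'')) :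
    bornDying k d h h' h'' = 1 := by
  let D' := deadClasses k d h (SetPair.le_trans' h' h'')
  let D := (deadClasses k d h h').submoduleOf D'
  have hzD : (⟨z, hd⟩ : D') ∉ D := by
    rintro ⟨y, hy⟩
    apply hz
    exact (congrArg φ hy).symm.trans (hφ y)
  refine finrank_eq_one_iff'.2 ⟨D.mkQ ⟨z, hd⟩, ?_, ?_⟩
  · rwa [Submodule.mkQ_apply, Ne, Submodule.Quotient.mk_eq_zero]
  · intro w
    obtain ⟨⟨x, hx⟩, rfl⟩ := D.mkQ_surjective w
    have hx' : x ∈ Submodule.span k {z} ⊔ LinearMap.range (relHomologyMap k d h) := by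
      rw [hspan]; trivial
    obtain ⟨_, h1, _, ⟨y, rfl⟩, rfl⟩ := Submodule.mem_sup.1 hx'
    obtain ⟨c, rfl⟩ := Submodule.mem_span_singleton.1 h1
    refine ⟨c, ?_⟩
    rw [← map_smul, ← sub_eq_zero, ← map_sub, Submodule.mkQ_apply, Submodule.Quotient.mk_eq_zero]
    -- The difference between `c • z` and `c • z` plus the image of `y` is the image of `-y`, which
    -- is an old class.
    refine ⟨-y, ?_⟩
    simp [relHomologyMap_comp_apply]

end BornDying

/-! ### Degree zero homology and path components -/

section PathComponents

variable (k : Type u) [Field k] {T : Type} [TopologicalSpace T]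

theorem surjective_relHomologyMap_zero {P Q : SetPair T} (h : P ≤ Q)
    (hj : ∀ y ∈ Q.big, ∃ x ∈ P.big, JoinedIn Q.big y x) :
    Function.Surjective (relHomologyMap k 0 h) := by
  rw [← LinearMap.range_eq_top, eq_top_iff, ← span_pointClass, Submodule.span_le]
  rintro _ ⟨⟨y, hy⟩, rfl⟩
  obtain ⟨x, hx, hyx⟩ := hj y hy
  refine ⟨pointClass k P ⟨x, hx⟩, ?_⟩
  rw [relHomologyMap_pointClass]
  exact (pointClass_eq_of_joined k hyx.joined_subtype).symm

/-- The points `z i` span the source and lie in different path components of the target, so the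
functionals of these components read off the coefficients. -/
theorem injective_relHomologyMap_zero {P Q : SetPair T} (h : P ≤ Q) (hQ : Q.small = ∅)
    {ι : Type} [Finite ι] (z : ι → P.big) (hz : ∀ x : P.big, ∃ i, Joined x (z i))
    (hn : ∀ i j, JoinedIn Q.big (z i) (z j) → i = j) :
    Function.Injective (relHomologyMap k 0 h) := by
  have := Fintype.ofFinite ι
  rw [injective_iff_map_eq_zero]
  intro x hx
  have hspan : Submodule.span k (Set.range fun i => pointClass k P (z i)) = ⊤ := by
    rw [← span_pointClass_of_joined k (Set.range z) fun x => ?_]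
    · rw [← Set.range_comp]; rfl
    · obtain ⟨i, hi⟩ := hz x
      exact ⟨z i, ⟨i, rfl⟩, hi⟩
  have hx' : x ∈ Submodule.span k (Set.range fun i => pointClass k P (z i)) := by
    rw [hspan]; trivial
  obtain ⟨c, rfl⟩ := (Submodule.mem_span_range_iff_exists_fun k).1 hx'
  refine Finset.sum_eq_zero fun j _ => ?_
  obtain ⟨φ, hφ⟩ := exists_functional k hQ (Set.inclusion h.1 (z j))
  have := congrArg φ hx
  simp only [map_sum, map_smul, relHomologyMap_pointClass, hφ, map_zero] at this
  rw [Finset.sum_eq_single j] at this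
  · rw [if_pos (Joined.refl _)] at this
    have hc : c j = 0 := by simpa using this
    rw [hc, zero_smul]
  · intro i _ hij
    rw [if_neg, smul_zero]
    intro hJ
    exact hij (hn i j ((joinedIn_iff_joined (h.1 (z i).2) (h.1 (z j).2)).2 hJ))
  · simp

/-- The elder rule: `z` represents the only new component, it is still separated from the old ones
in `Q`, and it then either merges with an old one or dies because all homology vanishes. The second
alternative serves the extended point. -/
theorem bornDying_zero_eq_one {P P' Q Q' : SetPair T} (h : P ≤ P') (h' : P' ≤ Q) (h'' : Q ≤ Q')
    (hQ : Q.small = ∅) (z : T) (hz : z ∈ P'.big)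
    (hgen : ∀ x ∈ P'.big, JoinedIn P'.big x z ∨ ∃ y ∈ P.big, JoinedIn P'.big x y)
    (hsep : ∀ y ∈ P.big, ¬ JoinedIn Q.big y z)
    (hdie : (∃ y ∈ P.big, JoinedIn Q'.big y z) ∨ Subsingleton (relHomology k 0 Q')) :
    bornDying k 0 h h' h'' = 1 := by
  obtain ⟨φ, hφ⟩ := exists_functional k hQ (⟨z, h'.1 hz⟩ : Q.big)
  refine bornDying_eq_one k h h' h'' (pointClass k P' ⟨z, hz⟩) ?_ φ ?_ ?_ ?_
  · rw [eq_top_iff, ← span_pointClass, Submodule.span_le]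
    rintro _ ⟨⟨x, hx⟩, rfl⟩
    rcases hgen x hx with hj | ⟨y, hy, hj⟩
    · rw [pointClass_eq_of_joined k hj.joined_subtype]
      exact Submodule.mem_sup_left (Submodule.mem_span_singleton_self _)
    · rw [pointClass_eq_of_joined k hj.joined_subtype]
      exact Submodule.mem_sup_right ⟨pointClass k P ⟨y, hy⟩, relHomologyMap_pointClass k h _⟩
  · have : φ ∘ₗ relHomologyMap k 0 (SetPair.le_trans' h h') = 0 := by
      apply LinearMap.ext_on_range (span_pointClass k P)
      rintro ⟨y, hy⟩
      rw [LinearMap.comp_apply, relHomologyMap_pointClass, hφ, if_neg, LinearMap.zero_apply]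
      intro hJ
      exact hsep y hy ((joinedIn_iff_joined (h'.1 (h.1 hy)) (h'.1 hz)).2 hJ)
    exact fun y => LinearMap.congr_fun this y
  · rw [relHomologyMap_pointClass, hφ, if_pos (Joined.refl _)]
    exact one_ne_zero
  · rcases hdie with ⟨y, hy, hj⟩ | hs
    · refine ⟨pointClass k P ⟨y, hy⟩, ?_⟩
      rw [relHomologyMap_pointClass, relHomologyMap_pointClass]
      exact pointClass_eq_of_joined k hj.joined_subtype
    · exact ⟨0, Subsingleton.elim _ _⟩

end PathComponents

/-! ### Gaps in a finite set of critical values -/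

/-- A finite set attains its supremum below `s`, so the midpoint lies strictly between the
neighbouring elements. The same reason gives the other three strict inequalities. -/
theorem lt_lowerGap {C : Set ℝ} (hC : C.Finite) {c s : ℝ} (hc : c ∈ C) (h : c < s) :
    c < lowerGap C s := by
  have hne : (C ∩ Set.Iio s).Nonempty := ⟨c, hc, h⟩
  have h1 : c ≤ sSup (C ∩ Set.Iio s) := le_csSup ⟨s, fun b hb => hb.2.le⟩ ⟨hc, h⟩
  have h2 : sSup (C ∩ Set.Iio s) < s := (hne.csSup_mem (hC.inter_of_left _)).2
  rw [lowerGap, if_pos hne]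
  linarith

theorem lowerGap_lt {C : Set ℝ} (hC : C.Finite) (s : ℝ) : lowerGap C s < s := by
  unfold lowerGap
  split_ifs with hne
  · have h2 : sSup (C ∩ Set.Iio s) < s := (hne.csSup_mem (hC.inter_of_left _)).2
    linarith
  · linarith

theorem upperGap_lt {C : Set ℝ} (hC : C.Finite) {c s : ℝ} (hc : c ∈ C) (h : s < c) :
    upperGap C s < c := by
  have hne : (C ∩ Set.Ioi s).Nonempty := ⟨c, hc, h⟩
  have h1 : sInf (C ∩ Set.Ioi s) ≤ c := csInf_le ⟨s, fun b hb => hb.2.le⟩ ⟨hc, h⟩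
  have h2 : s < sInf (C ∩ Set.Ioi s) := (hne.csInf_mem (hC.inter_of_left _)).2
  rw [upperGap, if_pos hne]
  linarith

theorem lt_upperGap {C : Set ℝ} (hC : C.Finite) (s : ℝ) : s < upperGap C s := by
  unfold upperGap
  split_ifs with hne
  · have h2 : s < sInf (C ∩ Set.Ioi s) := (hne.csInf_mem (hC.inter_of_left _)).2
    linarith
  · linarith

/-! ### Merge trees with three leaves -/

/-- A scalar field with the shape of a merge tree with root at height `5`, whose leaves at heights
`0`, `1`, `2` are merged at heights `3` (the youngest leaf) and `4`. -/
structure ThreeLeafTree (R : ScalarField) where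
  push : ℝ → R.carrier → R.carrier
  continuous_push : Continuous (Function.uncurry push)
  toFun_le : ∀ x, R.toFun x ≤ 5
  toFun_push : ∀ s ≤ 5, ∀ x, R.toFun (push s x) = max (R.toFun x) s
  push_of_le : ∀ s x, s ≤ R.toFun x → push s x = x
  leaf : Fin 3 → R.carrier
  toFun_leaf : ∀ i, R.toFun (leaf i) = (i : ℕ)
  exists_leaf : ∀ x, ∃ i : Fin 3, ((i : ℕ) : ℝ) ≤ R.toFun x ∧ push (R.toFun x) (leaf i) = x
  push_three : ∃ i ≠ 2, push 3 (leaf 2) = push 3 (leaf i)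
  push_four : ∀ i j, push 4 (leaf i) = push 4 (leaf j)
  not_joinedIn_four : ¬ JoinedIn (R.toFun ⁻¹' Set.Iio 4) (leaf 0) (leaf 1)
  not_joinedIn_three : ∀ i ≠ 2, ¬ JoinedIn (R.toFun ⁻¹' Set.Iio 3) (leaf i) (leaf 2)
  t1Space : T1Space R.carrier

namespace ThreeLeafTree

variable {R : ScalarField} (M : ThreeLeafTree R)
include M

theorem continuous_push_comp {α : Type} [TopologicalSpace α] {s : α → ℝ} {x : α → R.carrier}
    (hs : Continuous s) (hx : Continuous x) : Continuous fun a => M.push (s a) (x a) :=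
  M.continuous_push.comp (hs.prodMk hx)

/-- The path lets the push height run linearly from the height of `x`, where the push is trivial, to
`s`. -/
theorem joinedIn_push {a s : ℝ} {x : R.carrier} (hx : R.toFun x ≤ a) (hs : s ≤ a) (hs5 : s ≤ 5) :
    JoinedIn (R.toFun ⁻¹' Set.Iic a) x (M.push s x) := by
  refine ⟨⟨⟨fun t : unitInterval => M.push ((1 - t) * R.toFun x + t * s) x,
    M.continuous_push_comp (by fun_prop) continuous_const⟩, ?_, ?_⟩, fun t => ?_⟩
  · simpa using M.push_of_le _ _ le_rfl
  · simp
  · have h0 := t.2.1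
    have h1 := t.2.2
    have h5 := M.toFun_le x
    -- The bound by 5 makes `toFun_push` applicable; the bound by `a` keeps the path in the sublevel
    -- set.
    have hle : (1 - (t : ℝ)) * R.toFun x + t * s ≤ min 5 a := by
      have e1 : (1 - (t : ℝ)) * R.toFun x ≤ (1 - (t : ℝ)) * min 5 a :=
        mul_le_mul_of_nonneg_left (le_min h5 hx) (by linarith)
      have e2 : (t : ℝ) * s ≤ t * min 5 a := mul_le_mul_of_nonneg_left (le_min hs5 hs) h0
      linarith
    change R.toFun (M.push _ x) ≤ a
    rw [M.toFun_push _ (hle.trans (min_le_left _ _))]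
    exact max_le hx (hle.trans (min_le_right _ _))

theorem exists_joinedIn_leaf {a : ℝ} {x : R.carrier} (hx : R.toFun x ≤ a) :
    ∃ i : Fin 3, ((i : ℕ) : ℝ) ≤ a ∧ JoinedIn (R.toFun ⁻¹' Set.Iic a) x (M.leaf i) := by
  obtain ⟨i, hi, hp⟩ := M.exists_leaf x
  refine ⟨i, hi.trans hx, ?_⟩
  have := M.joinedIn_push (a := a) (s := R.toFun x) (x := M.leaf i)
    (by rw [M.toFun_leaf]; exact hi.trans hx) hx (M.toFun_le x)
  rw [hp] at this
  exact this.symm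

theorem joinedIn_leaf_leaf {a : ℝ} (ha : 4 ≤ a) (i j : Fin 3) :
    JoinedIn (R.toFun ⁻¹' Set.Iic a) (M.leaf i) (M.leaf j) := by
  have h (i : Fin 3) := M.joinedIn_push (a := a) (s := 4) (x := M.leaf i)
    (by rw [M.toFun_leaf]; fin_cases i <;> norm_num <;> linarith) ha (by norm_num)
  have hi := h i
  rw [M.push_four i j] at hi
  exact hi.trans (h j).symm

theorem exists_joinedIn_leaf_two {a : ℝ} (ha : 3 ≤ a) :
    ∃ i ≠ 2, JoinedIn (R.toFun ⁻¹' Set.Iic a) (M.leaf 2) (M.leaf i) := by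
  obtain ⟨i, hi, hp⟩ := M.push_three
  have h (i : Fin 3) := M.joinedIn_push (a := a) (s := 3) (x := M.leaf i)
    (by rw [M.toFun_leaf]; fin_cases i <;> norm_num <;> linarith) ha (by norm_num)
  have h2 := h 2
  rw [hp] at h2
  exact ⟨i, hi, h2.trans (h i).symm⟩

theorem exists_joinedIn_leaf_of_three_le {a : ℝ} (ha : 3 ≤ a) {x : R.carrier}
    (hx : R.toFun x ≤ a) : ∃ i ≠ 2, JoinedIn (R.toFun ⁻¹' Set.Iic a) x (M.leaf i) := by
  obtain ⟨i, -, hi⟩ := M.exists_joinedIn_leaf hx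
  by_cases h : i = 2
  · subst h
    obtain ⟨j, hj, hij⟩ := M.exists_joinedIn_leaf_two ha
    exact ⟨j, hj, hi.trans hij⟩
  · exact ⟨i, h, hi⟩

theorem joinedIn_leaf_of_four_le {a : ℝ} (ha : 4 ≤ a) {x : R.carrier}
    (hx : R.toFun x ≤ a) (i : Fin 3) : JoinedIn (R.toFun ⁻¹' Set.Iic a) x (M.leaf i) := by
  obtain ⟨j, -, hj⟩ := M.exists_joinedIn_leaf hx
  exact hj.trans (M.joinedIn_leaf_leaf ha j i)

theorem pathConnectedSpace : PathConnectedSpace R.carrier where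
  nonempty := ⟨M.leaf 0⟩
  joined x y := by
    have h (x : R.carrier) := M.joinedIn_leaf_of_four_le (a := 5) (by norm_num) (M.toFun_le x) 0
    exact ((h x).trans (h y).symm).joined

theorem finite_level (a : ℝ) : (R.toFun ⁻¹' {a}).Finite := by
  refine (Set.finite_range fun i => M.push a (M.leaf i)).subset ?_
  rintro x rfl
  obtain ⟨i, -, hi⟩ := M.exists_leaf x
  exact ⟨i, hi⟩

theorem totallyDisconnectedSpace_level (a : ℝ) :
    TotallyDisconnectedSpace (R.toFun ⁻¹' {a} : Set R.carrier) := by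
  have := M.t1Space
  have := (M.finite_level a).to_subtype
  infer_instance

variable (k : Type u) [Field k]

/-- Pushing up deforms the sublevel set into its top level, which is finite and hence discrete. -/
theorem subsingleton_relHomology_sub {d : ℕ} (hd : d ≠ 0) (a : ℝ) :
    Subsingleton (relHomology k d (R.sub a)) := by
  -- There are no points above height 5, so for larger `a` the top level is that of the root.
  let b := min a 5
  have hb : b ≤ a := min_le_left _ _
  have hb5 : b ≤ 5 := min_le_right _ _
  have hx {x : R.carrier} (h : R.toFun x ≤ a) : R.toFun x ≤ b := le_min h (M.toFun_le x)
  have := M.totallyDisconnectedSpace_level b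
  have hF : R.toFun ⁻¹' {b} ⊆ (R.sub a).big := by
    intro x hxb
    exact (Set.mem_singleton_iff.1 hxb).trans_le hb
  refine subsingleton_relHomology_of_homotopy_discrete k (P := R.sub a) rfl hF
    ⟨fun x => ⟨M.push b x, ?_⟩, ?_⟩ ⟨⟨fun q => ⟨M.push ((1 - q.1) * R.toFun q.2 + q.1 * b) q.2,
      ?_⟩, ?_⟩, ?_, ?_⟩ hd
  · change R.toFun _ = b
    rw [M.toFun_push b hb5]
    exact max_eq_right (hx x.2)
  · exact (M.continuous_push_comp continuous_const continuous_subtype_val).subtype_mk _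
  · have h0 := q.1.2.1
    have h1 := q.1.2.2
    have h2 := hx q.2.2
    have hle : (1 - (q.1 : ℝ)) * R.toFun q.2 + q.1 * b ≤ b := by nlinarith
    change R.toFun _ ≤ a
    rw [M.toFun_push _ (hle.trans hb5)]
    exact max_le q.2.2 (hle.trans hb)
  · refine Continuous.subtype_mk (M.continuous_push_comp ?_ (by fun_prop)) _
    have := R.continuous_toFun
    fun_prop
  · intro x
    simpa using Subtype.ext (M.push_of_le _ _ le_rfl)
  · intro x
    apply Subtype.ext
    simp

/-- Pushing up to height `a` fixes the superlevel set and deforms the whole tree onto it. -/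
theorem subsingleton_relHomology_sup (d : ℕ) {a : ℝ} (ha : a ≤ 5) :
    Subsingleton (relHomology k d (R.sup a)) := by
  refine subsingleton_relHomology_of_retract k (P := R.sup a)
    ⟨fun x => ⟨M.push a x, ?_⟩, ?_⟩ ?_ ⟨⟨fun q => ⟨M.push ((1 - q.1) * R.toFun q.2 + q.1 * a) q.2,
      trivial⟩, ?_⟩, ?_, ?_⟩ d
  · change a ≤ R.toFun _
    rw [M.toFun_push _ ha]
    exact le_max_right _ _
  · exact (M.continuous_push_comp continuous_const continuous_subtype_val).subtype_mk _
  · intro x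
    exact Subtype.ext (M.push_of_le _ _ x.2)
  · refine Continuous.subtype_mk (M.continuous_push_comp ?_ (by fun_prop)) _
    have := R.continuous_toFun
    fun_prop
  · intro x
    simpa using Subtype.ext (M.push_of_le _ _ le_rfl)
  · intro x
    apply Subtype.ext
    simp

theorem sup_small_eq_empty {a : ℝ} (ha : 5 < a) : (R.sup a).small = ∅ := by
  refine Set.eq_empty_of_forall_notMem fun x hx => ?_
  have h : a ≤ R.toFun x := hx
  linarith [M.toFun_le x]

end ThreeLeafTree

/-! ### The diagram of a merge tree with three leaves -/

namespace ThreeLeafTree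

theorem eq_leaf_zero_of_lt {i : Fin 3} {a : ℝ} (h : ((i : ℕ) : ℝ) ≤ a) (ha : a < 1) : i = 0 := by
  have : ((i : ℕ) : ℝ) < (1 : ℕ) := by push_cast; linarith
  have := Nat.cast_lt.1 this
  omega

theorem leaf_ne_two_of_lt {i : Fin 3} {a : ℝ} (h : ((i : ℕ) : ℝ) ≤ a) (ha : a < 2) : i ≠ 2 := by
  rintro rfl
  norm_num at h
  linarith

variable {R : ScalarField} (M : ThreeLeafTree R) (k : Type u) [Field k]
include M

theorem toFun_leaf_le_of_ne {i : Fin 3} (h : i ≠ 2) : R.toFun (M.leaf i) ≤ 1 := by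
  rw [M.toFun_leaf]
  fin_cases i <;> simp at h ⊢

theorem toFun_leaf_le (i : Fin 3) : R.toFun (M.leaf i) ≤ 2 := by
  rw [M.toFun_leaf]
  fin_cases i <;> norm_num

section Ordinary

variable {x y z w : ℝ} (hxy : x ≤ y) (hyz : y ≤ z) (hzw : z ≤ w)

theorem surjective_sub_of_leaf_mem {Q : SetPair R.carrier} (h : R.sub x ≤ Q)
    (hj : ∀ a ∈ Q.big, ∃ i, R.toFun (M.leaf i) ≤ x ∧ JoinedIn Q.big a (M.leaf i)) :
    Function.Surjective (relHomologyMap k 0 h) :=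
  surjective_relHomologyMap_zero k h fun a ha => by
    obtain ⟨i, hi, hj⟩ := hj a ha
    exact ⟨_, hi, hj⟩

/-- Here `x` and `y` bracket the birth value, `z` and `w` the death value. In this and the next two
lemmas, every component at `z` already contains a leaf of the sublevel set at `x`; in the two after
them, the components at `y` are still distinct at `w`. -/
theorem bornDying_sub_of_two_lt (hx : 2 < x) :
    bornDying k 0 (R.sub_le_sub hxy) (R.sub_le_sub hyz) (R.sub_le_sub hzw) = 0 :=
  bornDying_eq_zero_of_surjective k _ _ _ <| M.surjective_sub_of_leaf_mem k _ fun a ha => by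
    obtain ⟨i, -, hi⟩ := M.exists_joinedIn_leaf ha
    exact ⟨i, (M.toFun_leaf_le i).trans hx.le, hi⟩

theorem bornDying_sub_of_three_lt (hx : 1 < x) (hz : 3 < z) :
    bornDying k 0 (R.sub_le_sub hxy) (R.sub_le_sub hyz) (R.sub_le_sub hzw) = 0 :=
  bornDying_eq_zero_of_surjective k _ _ _ <| M.surjective_sub_of_leaf_mem k _ fun a ha => by
    obtain ⟨i, h, hi⟩ := M.exists_joinedIn_leaf_of_three_le hz.le ha
    exact ⟨i, (M.toFun_leaf_le_of_ne h).trans hx.le, hi⟩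

theorem bornDying_sub_of_four_lt (hx : 0 < x) (hz : 4 < z) :
    bornDying k 0 (R.sub_le_sub hxy) (R.sub_le_sub hyz) (R.sub_le_sub hzw) = 0 :=
  bornDying_eq_zero_of_surjective k _ _ _ <| M.surjective_sub_of_leaf_mem k _ fun a ha =>
    ⟨0, by rw [M.toFun_leaf]; simpa using hx.le, M.joinedIn_leaf_of_four_le hz.le ha 0⟩

theorem bornDying_sub_of_lt_one (hy0 : 0 < y) (hy : y < 1) :
    bornDying k 0 (R.sub_le_sub hxy) (R.sub_le_sub hyz) (R.sub_le_sub hzw) = 0 := by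
  refine bornDying_eq_zero_of_injective k _ _ _ (injective_relHomologyMap_zero k _ rfl
    (fun _ : Unit => ⟨M.leaf 0, ?_⟩) ?_ fun _ _ _ => rfl)
  · change R.toFun _ ≤ y
    rw [M.toFun_leaf]
    simpa using hy0.le
  · rintro ⟨a, ha⟩
    obtain ⟨i, hi, hj⟩ := M.exists_joinedIn_leaf ha
    obtain rfl := eq_leaf_zero_of_lt hi hy
    exact ⟨(), hj.joined_subtype⟩

theorem bornDying_sub_of_lt_two (hy1 : 1 < y) (hy : y < 2) (hw : w < 4) :
    bornDying k 0 (R.sub_le_sub hxy) (R.sub_le_sub hyz) (R.sub_le_sub hzw) = 0 := by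
  have hne (b : Bool) : (cond b 0 1 : Fin 3) ≠ 2 := by cases b <;> decide
  refine bornDying_eq_zero_of_injective k _ _ _ (injective_relHomologyMap_zero k _ rfl
    (fun b : Bool => ⟨M.leaf (cond b 0 1), (M.toFun_leaf_le_of_ne (hne b)).trans hy1.le⟩) ?_ ?_)
  · rintro ⟨a, ha⟩
    obtain ⟨i, hi, hj⟩ := M.exists_joinedIn_leaf ha
    have h2 := leaf_ne_two_of_lt hi hy
    by_cases h0 : i = 0
    · subst h0
      exact ⟨true, hj.joined_subtype⟩
    · have h1 : i = 1 := by omega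
      subst h1
      exact ⟨false, hj.joined_subtype⟩
  · have hn (h : JoinedIn (R.toFun ⁻¹' Set.Iic w) (M.leaf 0) (M.leaf 1)) : False :=
      M.not_joinedIn_four (h.mono (Set.preimage_mono (Set.Iic_subset_Iio.2 hw)))
    intro i j hij
    cases i <;> cases j
    · rfl
    · exact (hn hij.symm).elim
    · exact (hn hij).elim
    · rfl

/-- Leaf 2 is younger than both other leaves, so its class dies at height 3 whichever of them it
meets. -/
theorem bornDying_sub_two_three (hx : 1 < x) (hx' : x < 2) (hy : 2 < y)
    (hz : z < 3) (hw : 3 < w) :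
    bornDying k 0 (R.sub_le_sub hxy) (R.sub_le_sub hyz) (R.sub_le_sub hzw) = 1 := by
  refine bornDying_zero_eq_one k _ _ _ rfl (M.leaf 2) ((M.toFun_leaf_le 2).trans hy.le) ?_ ?_
    (Or.inl ?_)
  · intro a ha
    obtain ⟨i, -, hj⟩ := M.exists_joinedIn_leaf ha
    by_cases h2 : i = 2
    · subst h2
      exact Or.inl hj
    · exact Or.inr ⟨_, (M.toFun_leaf_le_of_ne h2).trans hx.le, hj⟩
  · intro a ha hj
    obtain ⟨i, hi, hia⟩ := M.exists_joinedIn_leaf ha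
    refine M.not_joinedIn_three i (leaf_ne_two_of_lt hi hx') ?_
    have h1 : JoinedIn (R.toFun ⁻¹' Set.Iic z) a (M.leaf i) :=
      hia.mono (Set.preimage_mono (Set.Iic_subset_Iic.2 (hxy.trans hyz)))
    exact (h1.symm.trans hj).mono (Set.preimage_mono (Set.Iic_subset_Iio.2 hz))
  · obtain ⟨i, hi, hj⟩ := M.exists_joinedIn_leaf_two hw.le
    exact ⟨_, (M.toFun_leaf_le_of_ne hi).trans hx.le, hj.symm⟩

/-- Leaf 1 meets the older leaf 0 only at height 4, even if it absorbs leaf 2 before. -/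
theorem bornDying_sub_one_four (hx : 0 < x) (hx' : x < 1) (hy1 : 1 < y) (hy : y < 2)
    (hz : z < 4) (hw : 4 < w) :
    bornDying k 0 (R.sub_le_sub hxy) (R.sub_le_sub hyz) (R.sub_le_sub hzw) = 1 := by
  have h0 : R.toFun (M.leaf 0) ≤ x := by
    rw [M.toFun_leaf]
    simpa using hx.le
  refine bornDying_zero_eq_one k _ _ _ rfl (M.leaf 1)
    ((M.toFun_leaf_le_of_ne (by decide)).trans hy1.le) ?_ ?_
    (Or.inl ⟨M.leaf 0, h0, M.joinedIn_leaf_leaf hw.le _ _⟩)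
  · intro a ha
    obtain ⟨i, hi, hj⟩ := M.exists_joinedIn_leaf ha
    have h2 := leaf_ne_two_of_lt hi hy
    by_cases h1 : i = 1
    · subst h1
      exact Or.inl hj
    · obtain rfl : i = 0 := by omega
      exact Or.inr ⟨_, h0, hj⟩
  · intro a ha hj
    obtain ⟨i, hi, hia⟩ := M.exists_joinedIn_leaf ha
    obtain rfl := eq_leaf_zero_of_lt hi hx'
    have h1 : JoinedIn (R.toFun ⁻¹' Set.Iic z) a (M.leaf 0) :=
      hia.mono (Set.preimage_mono (Set.Iic_subset_Iic.2 (hxy.trans hyz)))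
    exact M.not_joinedIn_four
      ((h1.symm.trans hj).mono (Set.preimage_mono (Set.Iic_subset_Iio.2 hz)))

end Ordinary

section Extended

variable {x y z w : ℝ} (hxy : x ≤ y) (hzw : w ≤ z)

/-- The relative homology already vanishes at `z`, so everything has died before. -/
theorem bornDying_ext_of_lt_five (d : ℕ) (hz : z < 5) :
    bornDying k d (R.sub_le_sub hxy) (R.sub_le_sup y z) (R.sup_le_sup hzw) = 0 := by
  have := M.subsingleton_relHomology_sup k d hz.le
  exact bornDying_eq_zero_of_surjective k _ _ _ fun b => ⟨0, Subsingleton.elim _ _⟩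

theorem bornDying_ext_of_pos (hx : 0 < x) :
    bornDying k 0 (R.sub_le_sub hxy) (R.sub_le_sup y z) (R.sup_le_sup hzw) = 0 := by
  refine bornDying_eq_zero_of_surjective k _ _ _ <| M.surjective_sub_of_leaf_mem k _ fun a _ =>
    ⟨0, by rw [M.toFun_leaf]; simpa using hx.le, ?_⟩
  exact (M.joinedIn_leaf_of_four_le (a := 5) (by norm_num) (M.toFun_le a) 0).mono
    (Set.subset_univ _)

theorem toFun_nonneg (a : R.carrier) : 0 ≤ R.toFun a := by
  obtain ⟨i, hi, -⟩ := M.exists_leaf a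
  exact (Nat.cast_nonneg _).trans hi

/-- For `z` above 5 the superlevel set is empty and the class of leaf 0 lives in the homology of the
whole tree; as soon as the superlevel set contains the root, all homology vanishes. -/
theorem bornDying_ext_zero_five (hx : x < 0) (hy0 : 0 < y) (hy : y < 1) (hw : w < 5)
    (hz : 5 < z) :
    bornDying k 0 (R.sub_le_sub hxy) (R.sub_le_sup y z) (R.sup_le_sup hzw) = 1 := by
  refine bornDying_zero_eq_one k _ _ _ (M.sup_small_eq_empty hz) (M.leaf 0) ?_ ?_ ?_
    (Or.inr (M.subsingleton_relHomology_sup k 0 hw.le))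
  · change R.toFun _ ≤ y
    rw [M.toFun_leaf]
    simpa using hy0.le
  · intro a ha
    obtain ⟨i, hi, hj⟩ := M.exists_joinedIn_leaf ha
    obtain rfl := eq_leaf_zero_of_lt hi hy
    exact Or.inl hj
  · intro a ha
    have h : R.toFun a ≤ x := ha
    linarith [M.toFun_nonneg a]

end Extended

/-- The extended persistence diagram of a merge tree with three leaves. -/
def diagram (d : ℕ) (c : PairClass) (p : ℝ × ℝ) : Prop :=
  d = 0 ∧ (c = .ord ∧ (p = (1, 4) ∨ p = (2, 3)) ∨ c = .ext ∧ p = (0, 5))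

open Classical in
omit M in
theorem exDgm_eq (M : ThreeLeafTree R) (hC : R.criticalValues = {0, 1, 2, 3, 4, 5}) :
    R.exDgm k = fun d c p => if diagram d c p then 1 else 0 := by
  funext d c ⟨s, t⟩
  have hfin : R.criticalValues.Finite := by rw [hC]; exact Set.toFinite _
  have hmem (r : ℝ) : r ∈ R.criticalValues ↔ r = 0 ∨ r = 1 ∨ r = 2 ∨ r = 3 ∨ r = 4 ∨ r = 5 := by
    rw [hC]; simp
  have l1 := fun r => lowerGap_lt hfin r
  have l2 := fun r => lt_upperGap hfin r
  have l3 := fun c hc r => lt_lowerGap (c := c) (s := r) hfin hc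
  have l4 := fun c hc r => upperGap_lt (c := c) (s := r) hfin hc
  have hle5 (r : ℝ) (hr : r ∈ R.criticalValues) : r ≤ 5 := by
    rcases (hmem r).1 hr with h | h | h | h | h | h <;> rw [h] <;> norm_num
  unfold ScalarField.exDgm
  by_cases hst : s ∈ R.criticalValues ∧ t ∈ R.criticalValues
  swap
  · rw [dif_neg hst, if_neg]
    rintro ⟨-, ⟨-, h | h⟩ | ⟨-, h⟩⟩ <;> obtain ⟨rfl, rfl⟩ := Prod.mk.inj h <;>
      exact hst ⟨(hmem _).2 (by norm_num), (hmem _).2 (by norm_num)⟩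
  rw [dif_pos hst]
  obtain ⟨hs, ht⟩ := hst
  cases c with
  | rel =>
    rw [if_neg (by simp [diagram])]
    dsimp only
    split_ifs with h
    -- A relative class born at `s` would live just below `s`, hence below 5, where the relative
    -- homology is zero.
    · have := M.subsingleton_relHomology_sup k d ((lowerGap_le R.criticalValues s).trans (hle5 s hs))
      exact bornDying_eq_zero_of_subsingleton k _ _ _
    · rfl
  | ord =>
    dsimp only
    have m0 : (0 : ℝ) ∈ R.criticalValues := (hmem _).2 (by norm_num)
    have m1 : (1 : ℝ) ∈ R.criticalValues := (hmem _).2 (by norm_num)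
    have m2 : (2 : ℝ) ∈ R.criticalValues := (hmem _).2 (by norm_num)
    have m3 : (3 : ℝ) ∈ R.criticalValues := (hmem _).2 (by norm_num)
    have m4 : (4 : ℝ) ∈ R.criticalValues := (hmem _).2 (by norm_num)
    by_cases h : s < t
    swap
    · rw [dif_neg h, if_neg]
      rintro ⟨-, ⟨-, h' | h'⟩ | ⟨-, h'⟩⟩ <;> obtain ⟨rfl, rfl⟩ := Prod.mk.inj h' <;>
        exact h (by norm_num)
    rw [dif_pos h]
    have b1 := lowerGap_le_upperGap R.criticalValues s
    have b2 := upperGap_le_lowerGap hs ht h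
    have b3 := lowerGap_le_upperGap R.criticalValues t
    by_cases hd : d = 0
    swap
    · rw [if_neg fun hD => hd hD.1]
      have := M.subsingleton_relHomology_sub k hd (upperGap R.criticalValues s)
      exact bornDying_eq_zero_of_subsingleton k _ _ _
    subst hd
    by_cases hs3 : 2 < s
    · rw [if_neg (by
        rintro ⟨-, ⟨-, h' | h'⟩ | ⟨-, h'⟩⟩ <;> obtain ⟨rfl, rfl⟩ := Prod.mk.inj h' <;>
          norm_num at hs3)]
      exact M.bornDying_sub_of_two_lt k b1 b2 b3 (l3 2 m2 s hs3)
    have hs012 : s = 0 ∨ s = 1 ∨ s = 2 := by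
      rcases (hmem s).1 hs with h | h | h | h | h | h
      · exact Or.inl h
      · exact Or.inr (Or.inl h)
      · exact Or.inr (Or.inr h)
      all_goals exact absurd (by rw [h]; norm_num) hs3
    rcases hs012 with rfl | rfl | rfl
    · rw [if_neg (by simp [diagram])]
      exact M.bornDying_sub_of_lt_one k b1 b2 b3 (l2 0) (l4 1 m1 0 (by norm_num))
    · rcases lt_trichotomy t 4 with h4 | rfl | h4
      · rw [if_neg (by simp [diagram, h4.ne])]
        exact M.bornDying_sub_of_lt_two k b1 b2 b3 (l2 1) (l4 2 m2 1 (by norm_num)) (l4 4 m4 t h4)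
      · rw [if_pos ⟨rfl, Or.inl ⟨rfl, Or.inl rfl⟩⟩]
        exact M.bornDying_sub_one_four k b1 b2 b3 (l3 0 m0 1 (by norm_num)) (l1 1) (l2 1)
          (l4 2 m2 1 (by norm_num)) (l1 4) (l2 4)
      · rw [if_neg (by simp [diagram, h4.ne'])]
        exact M.bornDying_sub_of_four_lt k b1 b2 b3 (l3 0 m0 1 (by norm_num)) (l3 4 m4 t h4)
    · have h3 : 3 ≤ t := by
        rcases (hmem t).1 ht with h' | h' | h' | h' | h' | h' <;> linarith
      rcases h3.eq_or_lt with rfl | h3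
      · rw [if_pos ⟨rfl, Or.inl ⟨rfl, Or.inr rfl⟩⟩]
        exact M.bornDying_sub_two_three k b1 b2 b3 (l3 1 m1 2 (by norm_num)) (l1 2) (l2 2)
          (l1 3) (l2 3)
      · rw [if_neg (by simp [diagram, h3.ne'])]
        exact M.bornDying_sub_of_three_lt k b1 b2 b3 (l3 1 m1 2 (by norm_num)) (l3 3 m3 t h3)
  | ext =>
    dsimp only
    have m0 : (0 : ℝ) ∈ R.criticalValues := (hmem _).2 (by norm_num)
    have m1 : (1 : ℝ) ∈ R.criticalValues := (hmem _).2 (by norm_num)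
    have m5 : (5 : ℝ) ∈ R.criticalValues := (hmem _).2 (by norm_num)
    have b1 := lowerGap_le_upperGap R.criticalValues s
    have b3 := lowerGap_le_upperGap R.criticalValues t
    by_cases hd : d = 0
    swap
    · rw [if_neg fun hD => hd hD.1]
      have := M.subsingleton_relHomology_sub k hd (upperGap R.criticalValues s)
      exact bornDying_eq_zero_of_subsingleton k _ _ _
    subst hd
    rcases (hle5 t ht).lt_or_eq with h5 | rfl
    · rw [if_neg (by simp [diagram, h5.ne])]
      exact M.bornDying_ext_of_lt_five k b1 b3 0 (l4 5 m5 t h5)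
    have h0 : 0 ≤ s := by
      rcases (hmem s).1 hs with h' | h' | h' | h' | h' | h' <;> rw [h'] <;> norm_num
    rcases h0.eq_or_lt with rfl | h0
    · rw [if_pos ⟨rfl, Or.inr ⟨rfl, rfl⟩⟩]
      exact M.bornDying_ext_zero_five k b1 b3 (l1 0) (l2 0) (l4 1 m1 0 (by norm_num)) (l1 5) (l2 5)
    · rw [if_neg (by simp [diagram, h0.ne'])]
      exact M.bornDying_ext_of_pos k b1 b3 (l3 0 m0 s h0)

open Classical in
omit M in
theorem isGeneric (M : ThreeLeafTree R) (hC : R.criticalValues = {0, 1, 2, 3, 4, 5})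
    (hinj : Set.InjOn R.toFun R.vertices) : R.IsGeneric k := by
  refine ⟨hinj, ?_⟩
  have key (x : R.FullPoint k) : diagram x.1 x.2.1 x.2.2.1 ∧ (x.2.2.2 : ℕ) = 0 := by
    obtain ⟨d, c, p, n, hn⟩ := x
    rw [M.exDgm_eq k hC] at hn
    dsimp only at hn ⊢
    split_ifs at hn with h
    · exact ⟨h, by omega⟩
    · omega
  rintro ⟨d, c, p, n⟩ ⟨d', c', p', n'⟩ h
  obtain ⟨h1, h2⟩ := key ⟨d, c, p, n⟩
  obtain ⟨h3, h4⟩ := key ⟨d', c', p', n'⟩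
  dsimp only [ScalarField.fullPos] at h1 h2 h3 h4 h
  -- Each of the six critical values occurs exactly once among the coordinates of the three points.
  have hall : d = d' ∧ c = c' ∧ p = p' := by
    obtain ⟨rfl, ⟨rfl, rfl | rfl⟩ | ⟨rfl, rfl⟩⟩ := h1 <;>
    obtain ⟨rfl, ⟨rfl, rfl | rfl⟩ | ⟨rfl, rfl⟩⟩ := h3 <;>
    first
    | exact ⟨rfl, rfl, rfl⟩
    | (exfalso; norm_num at h)
  obtain ⟨rfl, rfl, rfl⟩ := hall
  have : n = n' := Fin.ext (h2.trans h4.symm)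
  rw [this]

end ThreeLeafTree

/-! ### Bottleneck distances between equal diagrams -/

theorem bottleneck_self {ι : Type} (P : ι → ℝ × ℝ) : bottleneck P P = 0 := by
  let M : DiagramMatching P P :=
    { source := {i | (P i).1 ≠ (P i).2}
      target := {i | (P i).1 ≠ (P i).2}
      source_offDiag := fun _ h => h
      target_offDiag := fun _ h => h
      toEquiv := Equiv.refl _ }
  refine le_antisymm ((iInf_le _ M).trans ?_) zero_le
  have h : ⨆ i ∈ {i | (P i).1 ≠ (P i).2}ᶜ, diagCost (P i) ≤ 0 := by
    refine iSup₂_le fun i hi => ?_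
    have : (P i).1 = (P i).2 := by simpa using hi
    simp [diagCost, this]
  refine max_le (iSup_le fun i => ?_) (max_le h h)
  exact (edist_self _).le

namespace ScalarField

variable (k : Type u) [Field k] {X Y : ScalarField}

theorem typeBottleneck_eq_zero (h : X.reeb.exDgm k = Y.reeb.exDgm k) (d : ℕ) (c : PairClass) :
    typeBottleneck k d c X Y = 0 := by
  -- Unfolded, index type and position map depend on the Reeb graph only through `exDgm`, so
  -- rewriting makes both families literally equal.
  change bottleneck (fun x : Σ p : ℝ × ℝ, Fin (X.reeb.exDgm k d c p) => x.1)
    (fun x : Σ p : ℝ × ℝ, Fin (Y.reeb.exDgm k d c p) => x.1) = 0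
  rw [h]
  exact bottleneck_self _

theorem gradedBottleneck_eq_zero (h : X.reeb.exDgm k = Y.reeb.exDgm k) :
    gradedBottleneck k X Y = 0 := by
  simp [gradedBottleneck, typeBottleneck_eq_zero k h]

theorem ungradedBottleneck_eq_zero (h : X.reeb.exDgm k = Y.reeb.exDgm k) :
    ungradedBottleneck k X Y = 0 := by
  change bottleneck
    (fun x : Σ (d : ℕ) (c : PairClass) (p : ℝ × ℝ), Fin (X.reeb.exDgm k d c p) => x.2.2.1)
    (fun x : Σ (d : ℕ) (c : PairClass) (p : ℝ × ℝ), Fin (Y.reeb.exDgm k d c p) => x.2.2.1) = 0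
  rw [h]
  exact bottleneck_self _

end ScalarField

/-! ### Separation, transport along isomorphisms, and the Reeb graph of a tree -/

theorem not_joinedIn_of_disjoint_open {T : Type} [TopologicalSpace T] {A U V : Set T}
    (hU : IsOpen U) (hV : IsOpen V) (hUV : Disjoint U V) (hA : A ⊆ U ∪ V) {x y : T}
    (hx : x ∈ U) (hy : y ∈ V) : ¬ JoinedIn A x y := by
  rintro ⟨γ, hγ⟩
  have hr : Set.range γ ⊆ U := (isPreconnected_range γ.continuous).subset_left_of_subset_union
    hU hV hUV ((Set.range_subset_iff.2 hγ).trans hA) ⟨x, ⟨0, γ.source⟩, hx⟩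
  exact hUV.le_bot ⟨hr ⟨1, γ.target⟩, hy⟩

namespace ScalarField.Isomorphic

theorem symm {X Y : ScalarField} (h : X.Isomorphic Y) : Y.Isomorphic X := by
  obtain ⟨h, hh⟩ := h
  exact ⟨h.symm, fun y => by rw [← hh, h.apply_symm_apply]⟩

theorem trans {X Y Z : ScalarField} (h : X.Isomorphic Y) (h' : Y.Isomorphic Z) :
    X.Isomorphic Z := by
  obtain ⟨h, hh⟩ := h
  obtain ⟨h', hh'⟩ := h'
  exact ⟨h.trans h', fun x => by simp [hh', hh]⟩

end ScalarField.Isomorphic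

namespace ThreeLeafTree

theorem nonempty_of_isomorphic {R R' : ScalarField} (M : ThreeLeafTree R) (h : R.Isomorphic R') :
    Nonempty (ThreeLeafTree R') := by
  obtain ⟨h, hh⟩ := h
  have hs (y : R'.carrier) : R.toFun (h.symm y) = R'.toFun y := by
    rw [← hh, h.apply_symm_apply]
  have hJ {S : Set ℝ} {x y : R.carrier} (hj : JoinedIn (R'.toFun ⁻¹' S) (h x) (h y)) :
      JoinedIn (R.toFun ⁻¹' S) x y := by
    obtain ⟨γ, hγ⟩ := hj
    refine ⟨(γ.map h.symm.continuous).cast (by simp) (by simp), fun t => ?_⟩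
    change R.toFun (h.symm (γ t)) ∈ S
    rw [hs]
    exact hγ t
  exact ⟨{
    push := fun s y => h (M.push s (h.symm y))
    continuous_push := h.continuous.comp
      (M.continuous_push_comp continuous_fst (h.symm.continuous.comp continuous_snd))
    toFun_le := fun y => by rw [← hs]; exact M.toFun_le _
    toFun_push := fun s hs5 y => by rw [hh, M.toFun_push s hs5, hs]
    push_of_le := fun s y hy => by
      rw [M.push_of_le s _ (by rwa [hs]), h.apply_symm_apply]
    leaf := fun i => h (M.leaf i)
    toFun_leaf := fun i => by rw [hh, M.toFun_leaf]
    exists_leaf := fun y => by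
      obtain ⟨i, hi, hp⟩ := M.exists_leaf (h.symm y)
      rw [hs] at hi hp
      exact ⟨i, hi, by rw [h.symm_apply_apply, hp, h.apply_symm_apply]⟩
    push_three := by
      obtain ⟨i, hi, hp⟩ := M.push_three
      exact ⟨i, hi, by simp [hp]⟩
    push_four := fun i j => by simp [M.push_four i j]
    not_joinedIn_four := fun hj => M.not_joinedIn_four (hJ hj)
    not_joinedIn_three := fun i hi hj => M.not_joinedIn_three i hi (hJ hj)
    t1Space := by
      have := M.t1Space
      exact t1Space_of_injective_of_continuous h.symm.injective h.symm.continuous }⟩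

/-- Level sets are totally disconnected, so their components are points and the quotient map is
injective; an injective quotient map is a homeomorphism. -/
theorem isomorphic_reeb {R : ScalarField} (M : ThreeLeafTree R) : R.Isomorphic R.reeb := by
  have hinj : Function.Injective (Quotient.mk R.reebSetoid) := by
    intro x y hxy
    have hy : y ∈ connectedComponentIn (R.toFun ⁻¹' {R.toFun x}) x := Quotient.exact hxy
    have := M.totallyDisconnectedSpace_level (R.toFun x)
    exact totallyDisconnectedSpace_subtype_iff.1 this _ (connectedComponentIn_subset _ _)
      isPreconnected_connectedComponentIn (mem_connectedComponentIn rfl) hy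
  have hq : Topology.IsQuotientMap (Quotient.mk R.reebSetoid) := isQuotientMap_quotient_mk'
  let e := (Equiv.ofBijective _ ⟨hinj, hq.surjective⟩)
  refine ⟨e.toHomeomorph fun s => ?_, fun x => rfl⟩
  exact hq.isOpen_preimage

end ThreeLeafTree

/-! ### The planar trees -/

namespace PlanarTree

/-- The abscissa at height `t` of the three strands of the planar trees: strand `1` joins strand
`0` at height `3`, strand `2` joins it at height `4`. -/
noncomputable def strand (j : Fin 3) (t : ℝ) : ℝ :=
  ![0, max 0 (3 - t), -max 0 (4 - t)] j

@[simp] theorem strand_zero (t : ℝ) : strand 0 t = 0 := rfl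
@[simp] theorem strand_one (t : ℝ) : strand 1 t = max 0 (3 - t) := rfl
@[simp] theorem strand_two (t : ℝ) : strand 2 t = -max 0 (4 - t) := rfl

@[fun_prop] theorem continuous_strand (j : Fin 3) : Continuous (strand j) := by
  fin_cases j
  · exact continuous_const
  · exact continuous_const.max (continuous_const.sub continuous_id)
  · exact (continuous_const.max (continuous_const.sub continuous_id)).neg

/-- The map that carries the abscissa of a point to the abscissa at height `t` of a point above
it. -/
noncomputable def clamp (t x : ℝ) : ℝ := max (strand 2 t) (min x (strand 1 t))

/-- The outer strands move monotonically towards strand 0, so a point on one of them is clamped to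
its new position. The formula does not mention `j`, which makes the upward flow continuous without a
case distinction. -/
theorem clamp_strand (j : Fin 3) {t t' : ℝ} (h : t ≤ t') :
    clamp t' (strand j t) = strand j t' := by
  fin_cases j <;> simp only [clamp, Fin.zero_eta, Fin.mk_one, Fin.reduceFinMk, strand_zero,
    strand_one, strand_two, max_def, min_def] <;> split_ifs <;> linarith

/-- The planar tree formed by the three strands up to height `5`, where strand `j` starts at
height `σ j`. -/
def treeSet (σ : Equiv.Perm (Fin 3)) : Set (ℝ × ℝ) :=
  {z | z.2 ≤ 5 ∧ ∃ j, ((σ j : ℕ) : ℝ) ≤ z.2 ∧ z.1 = strand j z.2}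

/-- The planar tree with its height function. -/
def tree (σ : Equiv.Perm (Fin 3)) : ScalarField where
  carrier := treeSet σ
  toFun z := z.1.2
  continuous_toFun := continuous_snd.comp continuous_subtype_val

variable (σ : Equiv.Perm (Fin 3))

instance : T2Space (tree σ).carrier := inferInstanceAs (T2Space (treeSet σ))

/-- The point at height `t` of strand `j`, or the closest point if there is none. -/
noncomputable def point (j : Fin 3) (t : ℝ) : (tree σ).carrier :=
  ⟨(strand j (max (σ j : ℕ) (min t 5)), max (σ j : ℕ) (min t 5)), by
    have : ((σ j : ℕ) : ℝ) ≤ 5 := by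
      have := (σ j).2
      exact_mod_cast (show (σ j : ℕ) ≤ 5 by omega)
    exact ⟨max_le this (min_le_right _ _), j, le_max_left _ _, rfl⟩⟩

@[fun_prop] theorem continuous_point (j : Fin 3) : Continuous (point σ j) :=
  Continuous.subtype_mk (by fun_prop) _

variable {σ}

theorem point_val {j : Fin 3} {t : ℝ} (h : ((σ j : ℕ) : ℝ) ≤ t) (h5 : t ≤ 5) :
    (point σ j t).1 = (strand j t, t) := by
  simp [point, h, h5]

theorem toFun_point {j : Fin 3} {t : ℝ} (h : ((σ j : ℕ) : ℝ) ≤ t) (h5 : t ≤ 5) :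
    (tree σ).toFun (point σ j t) = t :=
  congrArg Prod.snd (point_val h h5)

theorem exists_point (z : (tree σ).carrier) :
    ∃ j, ((σ j : ℕ) : ℝ) ≤ (tree σ).toFun z ∧ z = point σ j ((tree σ).toFun z) := by
  obtain ⟨⟨x, t⟩, h5, j, hj, hx⟩ := z
  obtain rfl : x = strand j t := hx
  exact ⟨j, hj, Subtype.ext (point_val hj h5).symm⟩

theorem toFun_le_five (z : (tree σ).carrier) : (tree σ).toFun z ≤ 5 := z.2.1

theorem point_eq_point {i j : Fin 3} {t : ℝ} (hi : ((σ i : ℕ) : ℝ) ≤ t)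
    (hj : ((σ j : ℕ) : ℝ) ≤ t) (h5 : t ≤ 5) (h : strand i t = strand j t) :
    point σ i t = point σ j t :=
  Subtype.ext (by rw [point_val hi h5, point_val hj h5, h])

theorem base_le_two (j : Fin 3) : ((σ j : ℕ) : ℝ) ≤ 2 := by
  exact_mod_cast (show (σ j : ℕ) ≤ 2 by omega)

theorem strand_eq_of_three_le {t : ℝ} (h : 3 ≤ t) : strand 0 t = strand 1 t := by
  rw [strand_zero, strand_one, max_eq_left (by linarith)]

theorem strand_eq_of_four_le {t : ℝ} (h : 4 ≤ t) (i j : Fin 3) : strand i t = strand j t := by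
  have h1 : strand 1 t = 0 := by rw [strand_one, max_eq_left (by linarith)]
  have h2 : strand 2 t = 0 := by rw [strand_two, max_eq_left (by linarith), neg_zero]
  have (i : Fin 3) : strand i t = 0 := by
    fin_cases i
    exacts [rfl, h1, h2]
  rw [this, this]

variable (σ) in
/-- Pushing the points of the tree up to height at least `s`. -/
noncomputable def push (s : ℝ) (z : (tree σ).carrier) : (tree σ).carrier :=
  ⟨(clamp (max z.1.2 (min s 5)) z.1.1, max z.1.2 (min s 5)), by
    obtain ⟨⟨x, t⟩, h5, j, hj, hx⟩ := z
    obtain rfl : x = strand j t := hx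
    exact ⟨max_le h5 (min_le_right _ _), j, hj.trans (le_max_left _ _),
      clamp_strand j (le_max_left _ _)⟩⟩

theorem push_point {j : Fin 3} {s t : ℝ} (h : ((σ j : ℕ) : ℝ) ≤ t) (hts : t ≤ s) (h5 : s ≤ 5) :
    push σ s (point σ j t) = point σ j s := by
  refine Subtype.ext ?_
  rw [point_val (h.trans hts) h5]
  change (clamp (max (point σ j t).1.2 (min s 5)) (point σ j t).1.1,
    max (point σ j t).1.2 (min s 5)) = (strand j s, s)
  rw [point_val h (hts.trans h5)]
  simp only [min_eq_left h5, max_eq_right hts, clamp_strand j hts]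

theorem continuous_push : Continuous (Function.uncurry (push σ)) := by
  refine Continuous.subtype_mk ?_ _
  have h1 : Continuous fun q : ℝ × (tree σ).carrier => q.2.1.1 :=
    continuous_fst.comp (continuous_subtype_val.comp continuous_snd)
  have h2 : Continuous fun q : ℝ × (tree σ).carrier => q.2.1.2 :=
    continuous_snd.comp (continuous_subtype_val.comp continuous_snd)
  have h3 : Continuous fun q : ℝ × (tree σ).carrier => max q.2.1.2 (min q.1 5) :=
    h2.max (continuous_fst.min continuous_const)
  exact (((continuous_strand 2).comp h3).max (h1.min ((continuous_strand 1).comp h3))).prodMk h3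

theorem toFun_push {s : ℝ} (hs : s ≤ 5) (z : (tree σ).carrier) :
    (tree σ).toFun (push σ s z) = max ((tree σ).toFun z) s := by
  change max z.1.2 (min s 5) = max z.1.2 s
  rw [min_eq_left hs]

theorem push_of_le {s : ℝ} {z : (tree σ).carrier} (h : s ≤ (tree σ).toFun z) :
    push σ s z = z := by
  obtain ⟨⟨x, t⟩, h5, j, hj, hx⟩ := z
  obtain rfl : x = strand j t := hx
  have hs : max t (min s 5) = t := max_eq_left ((min_le_left _ _).trans h)
  refine Subtype.ext ?_
  change (clamp (max t (min s 5)) (strand j t), max t (min s 5)) = (strand j t, t)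
  rw [hs, clamp_strand j le_rfl]

theorem continuous_abscissa : Continuous fun z : (tree σ).carrier => z.1.1 :=
  continuous_fst.comp continuous_subtype_val

theorem continuous_height : Continuous fun z : (tree σ).carrier => z.1.2 :=
  continuous_snd.comp continuous_subtype_val

/-- Below height `4`, strand `2` is separated from the other strands. -/
theorem not_joinedIn_of_neg {a b : (tree σ).carrier} (ha : a.1.1 < 0) (hb : 0 ≤ b.1.1)
    (h : JoinedIn ((tree σ).toFun ⁻¹' Set.Iio 4) a b) : False := by
  have hcov (z : (tree σ).carrier) (hz : z.1.2 < 4) : z.1.1 = z.1.2 - 4 ∨ 0 ≤ z.1.1 := by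
    obtain ⟨⟨x, t⟩, h5, j, hj, hx⟩ := z
    obtain rfl : x = strand j t := hx
    dsimp only at hz ⊢
    fin_cases j
    · right; simp
    · right; simp
    · left; simp [max_eq_right (show 0 ≤ 4 - t by linarith)]
  -- Below height 4, strand 2 lies on the line where the abscissa is the height minus 4, to the left
  -- of 0; the open set `V` is what lies to the right of that line.
  refine not_joinedIn_of_disjoint_open (U := {z : (tree σ).carrier | z.1.1 < 0 ∧ z.1.2 < 4})
    (V := {z : (tree σ).carrier | z.1.2 - 4 < z.1.1 ∧ z.1.2 < 4})
    ((isOpen_lt continuous_abscissa continuous_const).inter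
      (isOpen_lt continuous_height continuous_const))
    ((isOpen_lt (continuous_height.sub continuous_const) continuous_abscissa).inter
      (isOpen_lt continuous_height continuous_const)) ?_ ?_ ?_ ?_ h
  · rw [Set.disjoint_left]
    rintro z ⟨h1, h2⟩ ⟨h3, -⟩
    rcases hcov z h2 with h4 | h4 <;> linarith
  · intro z hz
    have hz4 : z.1.2 < 4 := hz
    rcases hcov z hz4 with h4 | h4
    · exact Or.inl ⟨by linarith, hz4⟩
    · exact Or.inr ⟨by linarith, hz4⟩
  · exact ⟨ha, h.source_mem⟩
  · have hb4 : b.1.2 < 4 := h.target_mem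
    exact ⟨by linarith, hb4⟩

/-- Below height `3`, strand `1` is separated from the other strands. -/
theorem not_joinedIn_of_pos {a b : (tree σ).carrier} (ha : a.1.1 ≤ 0) (hb : 0 < b.1.1)
    (h : JoinedIn ((tree σ).toFun ⁻¹' Set.Iio 3) a b) : False := by
  have hcov (z : (tree σ).carrier) (hz : z.1.2 < 3) : z.1.1 = 3 - z.1.2 ∨ z.1.1 ≤ 0 := by
    obtain ⟨⟨x, t⟩, h5, j, hj, hx⟩ := z
    obtain rfl : x = strand j t := hx
    dsimp only at hz ⊢
    fin_cases j
    · right; simp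
    · left; simp [max_eq_right (show 0 ≤ 3 - t by linarith)]
    · right; simp
  refine not_joinedIn_of_disjoint_open
    (U := {z : (tree σ).carrier | z.1.1 < 3 - z.1.2 ∧ z.1.2 < 3})
    (V := {z : (tree σ).carrier | 0 < z.1.1 ∧ z.1.2 < 3})
    ((isOpen_lt continuous_abscissa (continuous_const.sub continuous_height)).inter
      (isOpen_lt continuous_height continuous_const))
    ((isOpen_lt continuous_const continuous_abscissa).inter
      (isOpen_lt continuous_height continuous_const)) ?_ ?_ ?_ ?_ h
  · rw [Set.disjoint_left]
    rintro z ⟨h1, h2⟩ ⟨h3, -⟩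
    rcases hcov z h2 with h4 | h4 <;> linarith
  · intro z hz
    have hz4 : z.1.2 < 3 := hz
    rcases hcov z hz4 with h4 | h4
    · exact Or.inr ⟨by linarith, hz4⟩
    · exact Or.inl ⟨by linarith, hz4⟩
  · have ha4 : a.1.2 < 3 := h.source_mem
    exact ⟨by linarith, ha4⟩
  · exact ⟨hb, h.target_mem⟩

theorem base_symm (i : Fin 3) : ((σ (σ.symm i) : ℕ) : ℝ) = (i : ℕ) := by
  rw [Equiv.apply_symm_apply]

theorem cast_fin_le_two (i : Fin 3) : ((i : ℕ) : ℝ) ≤ 2 := by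
  exact_mod_cast (show (i : ℕ) ≤ 2 by omega)

variable (σ) in
/-- The lowest point of the strand that starts at height `i`. -/
noncomputable def leaf (i : Fin 3) : (tree σ).carrier := point σ (σ.symm i) (i : ℕ)

theorem leaf_val (i : Fin 3) : (leaf σ i).1 = (strand (σ.symm i) (i : ℕ), ((i : ℕ) : ℝ)) :=
  point_val (base_symm i).le ((cast_fin_le_two i).trans (by norm_num))

theorem push_leaf {i : Fin 3} {s : ℝ} (h : ((i : ℕ) : ℝ) ≤ s) (h5 : s ≤ 5) :
    push σ s (leaf σ i) = point σ (σ.symm i) s :=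
  push_point (base_symm i).le h h5

variable (σ) in
/-- If strand `1` starts at height `2`, the planar tree is a merge tree with three leaves. -/
noncomputable def threeLeafTree (hσ : σ 1 = 2) : ThreeLeafTree (tree σ) where
  push := push σ
  continuous_push := continuous_push
  toFun_le := toFun_le_five
  toFun_push := fun _ hs z => toFun_push hs z
  push_of_le := fun _ _ h => push_of_le h
  leaf := leaf σ
  toFun_leaf := fun i => congrArg Prod.snd (leaf_val i)
  exists_leaf := fun z => by
    obtain ⟨j, hj, hz⟩ := exists_point z
    refine ⟨σ j, hj, ?_⟩
    rw [push_leaf hj (toFun_le_five z), Equiv.symm_apply_apply]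
    exact hz.symm
  push_three := by
    have h1 : σ.symm 2 = 1 := by rw [← hσ, Equiv.symm_apply_apply]
    refine ⟨σ 0, fun h => by simpa using σ.injective (h.trans hσ.symm), ?_⟩
    have hle (i : Fin 3) : ((i : ℕ) : ℝ) ≤ 3 := (cast_fin_le_two i).trans (by norm_num)
    rw [push_leaf (hle _) (by norm_num), push_leaf (hle _) (by norm_num), h1,
      Equiv.symm_apply_apply]
    exact point_eq_point (hle _) (hle _) (by norm_num) (strand_eq_of_three_le le_rfl).symm
  push_four := fun i j => by
    have hle (i : Fin 3) : ((i : ℕ) : ℝ) ≤ 4 := (cast_fin_le_two i).trans (by norm_num)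
    rw [push_leaf (hle _) (by norm_num), push_leaf (hle _) (by norm_num)]
    exact point_eq_point (hle _) (hle _) (by norm_num) (strand_eq_of_four_le le_rfl _ _)
  not_joinedIn_four := fun h => by
    have h1 : σ.symm 2 = 1 := by rw [← hσ, Equiv.symm_apply_apply]
    have hne : σ.symm 0 ≠ σ.symm 1 := fun h => by simpa using σ.symm.injective h
    have h0 : σ.symm 0 ≠ 1 := fun h => by simpa using σ.symm.injective (h.trans h1.symm)
    have h0' : σ.symm 1 ≠ 1 := fun h => by simpa using σ.symm.injective (h.trans h1.symm)
    -- Strand 1 carries leaf 2, so one of the leaves 0 and 1 lies on strand 2 and the other on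
    -- strand 0.
    by_cases hz : σ.symm 0 = 0
    · have h2 : σ.symm 1 = 2 := by omega
      refine not_joinedIn_of_neg ?_ ?_ h.symm
      · rw [leaf_val, h2]
        norm_num
      · rw [leaf_val, hz]
        simp
    · have hz : σ.symm 0 = 2 := by omega
      have h2 : σ.symm 1 = 0 := by omega
      refine not_joinedIn_of_neg ?_ ?_ h
      · rw [leaf_val, hz]
        norm_num
      · rw [leaf_val, h2]
        simp
  not_joinedIn_three := fun i hi h => by
    have h1 : σ.symm 2 = 1 := by rw [← hσ, Equiv.symm_apply_apply]
    have hi1 : σ.symm i ≠ 1 := fun h => hi (σ.symm.injective (h.trans h1.symm))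
    refine not_joinedIn_of_pos ?_ ?_ h
    · rw [leaf_val]
      have : σ.symm i = 0 ∨ σ.symm i = 2 := by omega
      rcases this with h | h <;> rw [h] <;> simp
    · rw [leaf_val, h1]
      norm_num
  t1Space := inferInstance

end PlanarTree

/-! ### Constructibility of the planar trees -/

namespace PlanarTree

variable (σ : Equiv.Perm (Fin 3))

/-- The fiber of the planar tree at an integer height. -/
abbrev Fiber (i : ℕ) : Type := {z : (tree σ).carrier // (tree σ).toFun z = i}

variable {σ}

theorem finite_fiber (hσ : σ 1 = 2) (i : ℕ) : Finite (Fiber σ i) :=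
  ((threeLeafTree σ hσ).finite_level (i : ℝ)).to_subtype

theorem compactSpace_fiber (hσ : σ 1 = 2) (i : ℕ) : CompactSpace (Fiber σ i) := by
  have := finite_fiber hσ i
  infer_instance

theorem locallyPathConnectedSpace_fiber (hσ : σ 1 = 2) (i : ℕ) :
    LocallyPathConnectedSpace (Fiber σ i) := by
  have := finite_fiber hσ i
  infer_instance

/-- The map between consecutive fibers that pushes the points up. -/
noncomputable def raise (i : Fin 5) (e : Fiber σ i) : Fiber σ (i + 1) :=
  ⟨push σ (i + 1 : ℕ) e.1, by
    have h5 : (((i : ℕ) + 1 : ℕ) : ℝ) ≤ 5 := by exact_mod_cast i.2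
    rw [toFun_push h5, e.2]
    simp⟩

theorem continuous_raise (i : Fin 5) : Continuous (raise (σ := σ) i) :=
  (continuous_push.comp (continuous_const.prodMk continuous_subtype_val)).subtype_mk _

/-- The planar tree as glued from its fibers at integer heights and cylinders over them. -/
noncomputable def constructibleData (hσ : σ 1 = 2) : ConstructibleData where
  n := 5
  a i := (i : ℕ)
  a_strictMono := fun _ _ h => Nat.cast_lt.2 h
  V i := Fiber σ i
  E i := Fiber σ i
  compactV := fun i => compactSpace_fiber hσ i
  compactE := fun i => compactSpace_fiber hσ i
  locPathV := fun i => locallyPathConnectedSpace_fiber hσ i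
  locPathE := fun i => locallyPathConnectedSpace_fiber hσ i
  lower := fun _ e => e
  upper := raise
  continuous_lower := fun _ => continuous_id
  continuous_upper := continuous_raise

/-- The map to the planar tree from the pieces from which it is glued. -/
noncomputable def ofPieces (hσ : σ 1 = 2) : (constructibleData hσ).Pieces → (tree σ).carrier
  | Sum.inl v => v.2.1
  | Sum.inr p => push σ p.2.2 p.2.1.1

theorem continuous_ofPieces (hσ : σ 1 = 2) : Continuous (ofPieces hσ) := by
  refine continuous_sum_dom.2 ⟨?_, ?_⟩
  · exact continuous_sigma fun i =>
      (continuous_subtype_val : Continuous fun v : Fiber σ i => v.1)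
  · exact continuous_sigma fun i => continuous_push.comp
      ((continuous_subtype_val.comp continuous_snd).prodMk
        ((continuous_subtype_val : Continuous fun v : Fiber σ i => v.1).comp continuous_fst))

theorem toFun_ofPieces (hσ : σ 1 = 2) (x : (constructibleData hσ).Pieces) :
    (tree σ).toFun (ofPieces hσ x) = (constructibleData hσ).piecesHeight x := by
  rcases x with ⟨i, v⟩ | ⟨i, e, t⟩
  · exact v.2
  · have h1 : (tree σ).toFun e.1 ≤ t := e.2.trans_le t.2.1
    have h5 : (t : ℝ) ≤ 5 := t.2.2.trans (by
      change (((i : ℕ) + 1 : ℕ) : ℝ) ≤ 5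
      exact_mod_cast i.2)
    exact (toFun_push h5 e.1).trans (max_eq_right h1)

theorem ofPieces_eq_of_glue (hσ : σ 1 = 2) {x y : (constructibleData hσ).Pieces}
    (h : (constructibleData hσ).Glue x y) : ofPieces hσ x = ofPieces hσ y := by
  cases h with
  | lower i e t ht =>
    change push σ t e.1 = e.1
    exact push_of_le (ht.trans_le e.2.ge)
  | upper i e t ht =>
    change push σ t e.1 = push σ (i + 1 : ℕ) e.1
    rw [ht]
    rfl

/-- Strands merge only at the integer heights 3 and 4, so strands that agree at `t` already agreed
at the integer `i` below it. -/
theorem eq_of_push_eq {i : ℕ} {t : ℝ} (hi : i ≤ t) (ht : t < i + 1) (h5 : t ≤ 5)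
    {a b : Fiber σ i} (h : push σ t a.1 = push σ t b.1) : a = b := by
  obtain ⟨a, ha⟩ := a
  obtain ⟨b, hb⟩ := b
  obtain ⟨j, hj, ea⟩ := exists_point a
  obtain ⟨l, hl, eb⟩ := exists_point b
  rw [ha] at hj ea
  rw [hb] at hl eb
  subst ea eb
  refine Subtype.ext (point_eq_point hj hl (hi.trans h5) ?_)
  rw [push_point hj hi h5, push_point hl hi h5] at h
  have h' := congrArg (fun z => z.1.1) h
  rw [point_val (hj.trans hi) h5, point_val (hl.trans hi) h5] at h'
  have h3 (hh : 3 ≤ t) : (3 : ℝ) ≤ i := by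
    have : (3 : ℝ) < i + 1 := hh.trans_lt ht
    have : 3 < i + 1 := by exact_mod_cast this
    exact_mod_cast Nat.lt_succ_iff.1 this
  have h4 (hh : 4 ≤ t) : (4 : ℝ) ≤ i := by
    have : (4 : ℝ) < i + 1 := hh.trans_lt ht
    have : 4 < i + 1 := by exact_mod_cast this
    exact_mod_cast Nat.lt_succ_iff.1 this
  have key3 (hh : max 0 (3 - t) ≤ 0) : max 0 (3 - (i : ℝ)) = 0 :=
    max_eq_left (by linarith [h3 (by linarith [le_max_right 0 (3 - t)])])
  have key4 (hh : max 0 (4 - t) ≤ 0) : max 0 (4 - (i : ℝ)) = 0 :=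
    max_eq_left (by linarith [h4 (by linarith [le_max_right 0 (4 - t)])])
  have p3 := le_max_left 0 (3 - t)
  have p4 := le_max_left 0 (4 - t)
  have key43 (hh : max 0 (4 - t) ≤ 0) : max 0 (3 - t) ≤ 0 :=
    max_le le_rfl (by linarith [le_max_right 0 (4 - t)])
  fin_cases j <;> fin_cases l <;> simp only [Fin.zero_eta, Fin.mk_one, Fin.reduceFinMk,
    strand_zero, strand_one, strand_two] at h' ⊢
  · rw [key3 (by linarith)]
  · rw [key4 (by linarith), neg_zero]
  · rw [key3 (by linarith)]
  · rw [key3 (by linarith), key4 (by linarith), neg_zero]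
  · rw [key4 (by linarith), neg_zero]
  · rw [key3 (by linarith), key4 (by linarith), neg_zero]

/-- The pieces that represent every point of the glued space exactly once: the critical fibers
and the open cylinders. -/
def IsReduced {D : ConstructibleData} : D.Pieces → Prop
  | Sum.inl _ => True
  | Sum.inr p => D.a p.1.castSucc < p.2.2 ∧ (p.2.2 : ℝ) < D.a p.1.succ

theorem exists_isReduced {D : ConstructibleData} (x : D.Pieces) :
    ∃ y, IsReduced y ∧ Quot.mk D.Glue x = Quot.mk D.Glue y := by
  rcases x with v | ⟨i, e, t⟩
  · exact ⟨Sum.inl v, trivial, rfl⟩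
  · rcases t.2.1.eq_or_lt with h | h
    · exact ⟨Sum.inl _, trivial, Quot.sound (ConstructibleData.Glue.lower i e t h.symm)⟩
    rcases t.2.2.eq_or_lt with h' | h'
    · exact ⟨Sum.inl _, trivial, Quot.sound (ConstructibleData.Glue.upper i e t h')⟩
    · exact ⟨Sum.inr ⟨i, e, t⟩, ⟨h, h'⟩, rfl⟩

/-- The height decides whether a reduced piece is in a fiber (integer) or an open cylinder (not an
integer), and in which one. -/
theorem ofPieces_injOn (hσ : σ 1 = 2) {x y : (constructibleData hσ).Pieces} (hx : IsReduced x)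
    (hy : IsReduced y) (h : ofPieces hσ x = ofPieces hσ y) : x = y := by
  have hh := congrArg (tree σ).toFun h
  rw [toFun_ofPieces, toFun_ofPieces] at hh
  have hn {i j : ℕ} (h1 : (j : ℝ) < i) (h2 : (i : ℝ) < (j + 1 : ℕ)) : False := by
    have h1 := Nat.cast_lt.1 h1
    have h2 := Nat.cast_lt.1 h2
    omega
  rcases x with ⟨i, v⟩ | ⟨i, e, t⟩ <;> rcases y with ⟨j, w⟩ | ⟨j, e', t'⟩
  · obtain rfl : i = j := Fin.ext (Nat.cast_injective (R := ℝ) hh)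
    have : v = w := Subtype.ext h
    rw [this]
  · have hh' : ((i : ℕ) : ℝ) = t' := hh
    exact (hn (hh' ▸ hy.1) (hh' ▸ hy.2)).elim
  · have hh' : (t : ℝ) = ((j : ℕ) : ℝ) := hh
    exact (hn (hh' ▸ hx.1) (hh' ▸ hx.2)).elim
  · have hh' : (t : ℝ) = t' := hh
    have hi1 : ((i : ℕ) : ℝ) < t := hx.1
    have hi2 : (t : ℝ) < ((i + 1 : ℕ) : ℝ) := hx.2
    have hj1 : ((j : ℕ) : ℝ) < t' := hy.1
    have hj2 : (t' : ℝ) < ((j + 1 : ℕ) : ℝ) := hy.2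
    obtain rfl : i = j := by
      rw [hh'] at hi1 hi2
      have h1 := Nat.cast_lt.1 (hi1.trans hj2)
      have h2 := Nat.cast_lt.1 (hj1.trans hi2)
      exact Fin.ext (by omega)
    obtain rfl : t = t' := Subtype.ext hh'
    have h5 : (((i : ℕ) + 1 : ℕ) : ℝ) ≤ 5 := by exact_mod_cast i.2
    have : e = e' := eq_of_push_eq hi1.le (by exact_mod_cast hi2) (hi2.le.trans h5) h
    rw [this]

theorem ofPieces_surjective (hσ : σ 1 = 2) : Function.Surjective (ofPieces hσ) := by
  intro z
  obtain ⟨j, hj, hz⟩ := exists_point z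
  have h5 := toFun_le_five z
  rcases h5.eq_or_lt with h | h
  -- No cylinder starts at height 5, so the root comes from the last fiber; any other point comes
  -- from the cylinder that starts at the floor of its height.
  · exact ⟨Sum.inl ⟨Fin.last 5, z, by rw [h]; norm_num⟩, rfl⟩
  · have h0 : 0 ≤ (tree σ).toFun z := (Nat.cast_nonneg _).trans hj
    have hf := Nat.floor_le h0
    have hf' := Nat.lt_floor_add_one ((tree σ).toFun z)
    have hlt : ⌊(tree σ).toFun z⌋₊ < 5 := (Nat.floor_lt h0).2 (by exact_mod_cast h)
    have hjf : ((σ j : ℕ) : ℝ) ≤ ⌊(tree σ).toFun z⌋₊ := Nat.cast_le.2 (Nat.le_floor hj)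
    refine ⟨Sum.inr ⟨⟨_, hlt⟩, ⟨point σ j ⌊(tree σ).toFun z⌋₊, ?_⟩, ⟨(tree σ).toFun z, ?_⟩⟩, ?_⟩
    · exact toFun_point hjf (hf.trans h5)
    · exact ⟨hf, by change _ ≤ ((_ + 1 : ℕ) : ℝ); exact_mod_cast hf'.le⟩
    · exact (push_point hjf hf h5).trans hz.symm

/-- The glued space is compact, so a continuous bijection from it to the Hausdorff tree is a
homeomorphism. -/
theorem isConstructible (hσ : σ 1 = 2) : (tree σ).IsConstructible := by
  let D := constructibleData hσ
  refine ⟨D, ScalarField.Isomorphic.symm ?_⟩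
  have hV (i : Fin (D.n + 1)) : CompactSpace (D.V i) := D.compactV i
  have hE (i : Fin D.n) : CompactSpace (D.E i) := D.compactE i
  let F : D.glued.carrier → (tree σ).carrier :=
    Quot.lift (ofPieces hσ) fun _ _ h => ofPieces_eq_of_glue hσ h
  have hF : Continuous F := continuous_quot_lift _ (continuous_ofPieces hσ)
  have hb : Function.Bijective F := by
    constructor
    · rintro ⟨x⟩ ⟨y⟩ h
      obtain ⟨x', hx, ex⟩ := exists_isReduced x
      obtain ⟨y', hy, ey⟩ := exists_isReduced y
      refine ex.trans (Eq.trans ?_ ey.symm)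
      rw [ofPieces_injOn hσ hx hy]
      have h' : F (Quot.mk _ x) = F (Quot.mk _ y) := h
      rw [ex, ey] at h'
      exact h'
    · intro z
      obtain ⟨x, hx⟩ := ofPieces_surjective hσ z
      exact ⟨Quot.mk _ x, hx⟩
  have : CompactSpace D.glued.carrier := inferInstanceAs (CompactSpace (Quot D.Glue))
  refine ⟨Continuous.homeoOfEquivCompactToT2 (f := Equiv.ofBijective F hb) hF, ?_⟩
  rintro ⟨x⟩
  exact toFun_ofPieces hσ x

end PlanarTree

/-! ### Vertices, edges and multigraphs of one-dimensional complexes -/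

section EdgeModels

open Topology

namespace ScalarField

/-- A local extremum is a vertex. -/
theorem mem_vertices_of_isLocalExtr {R : ScalarField} {x : R.carrier}
    (h : IsLocalExtr R.toFun x) : x ∈ R.vertices := by
  rintro ⟨U, hU, hx, hf⟩
  have hnhds : Filter.map (fun y : U => R.toFun y) (𝓝 ⟨x, hx⟩) = 𝓝 (R.toFun x) :=
    hf.map_nhds_eq _
  have key (P : ℝ → Prop) (hP : ∀ᶠ y in 𝓝 x, P (R.toFun y)) : ∀ᶠ t in 𝓝 (R.toFun x), P t := by
    rw [← hnhds, Filter.eventually_map]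
    exact continuous_subtype_val.continuousAt.eventually (p := fun y => P (R.toFun y)) hP
  rcases h with h | h
  · have h1 := (key (fun t => R.toFun x ≤ t) h).filter_mono
      (nhdsWithin_le_nhds (s := Set.Iio (R.toFun x)))
    obtain ⟨t, h1, h2⟩ := (h1.and self_mem_nhdsWithin).exists
    exact not_lt_of_ge h1 h2
  · have h1 := (key (fun t => t ≤ R.toFun x) h).filter_mono
      (nhdsWithin_le_nhds (s := Set.Ioi (R.toFun x)))
    obtain ⟨t, h1, h2⟩ := (h1.and self_mem_nhdsWithin).exists
    exact not_lt_of_ge h1 h2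

/-- The upper end of two curves along which the function increases in the same way is a vertex if
the curves are disjoint below it. -/
theorem mem_vertices_of_merge {R : ScalarField} {c c' : ℝ → R.carrier} (hc : Continuous c)
    (hc' : Continuous c') {a b : ℝ} (hab : a < b) (h : ∀ t ∈ Set.Ioo a b, R.toFun (c t) = t)
    (h' : ∀ t ∈ Set.Ioo a b, R.toFun (c' t) = t) (hb : c b = c' b)
    (hne : ∀ t ∈ Set.Ioo a b, c t ≠ c' t) : c b ∈ R.vertices := by
  rintro ⟨U, hU, hx, hf⟩
  have e1 : ∀ᶠ t in 𝓝[<] b, c t ∈ U :=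
    (hc.continuousAt.eventually (hU.mem_nhds hx)).filter_mono nhdsWithin_le_nhds
  have e2 : ∀ᶠ t in 𝓝[<] b, c' t ∈ U :=
    (hc'.continuousAt.eventually (hU.mem_nhds (hb ▸ hx))).filter_mono nhdsWithin_le_nhds
  obtain ⟨t, ⟨h1, h2⟩, ht⟩ := ((e1.and e2).and (Ioo_mem_nhdsLT hab)).exists
  have := hf.injective (a₁ := ⟨c t, h1⟩) (a₂ := ⟨c' t, h2⟩) ((h t ht).trans (h' t ht).symm)
  exact hne t ht (congrArg Subtype.val this)

theorem apply_mem_vertices {R R' : ScalarField} (h : R.carrier ≃ₜ R'.carrier)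
    (hh : ∀ x, R'.toFun (h x) = R.toFun x) {x : R.carrier} (hx : x ∈ R.vertices) :
    h x ∈ R'.vertices := by
  rintro ⟨U, hU, hxU, hf⟩
  refine hx ⟨h ⁻¹' U, hU.preimage h.continuous, hxU, ?_⟩
  have he : IsOpenEmbedding (U.restrictPreimage h) :=
    h.isOpenEmbedding.restrictPreimage U
  convert hf.comp he using 1
  funext y
  exact (hh y).symm

end ScalarField

/-- A scalar field that is a one-dimensional complex: vertices `vtx i` at heights `ht i`, and for
every `e` an edge `γ e` on which the height is a coordinate, from `vtx (src e)` up to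
`vtx (tgt e)`. -/
structure EdgeModel {I J : Type} (R : ScalarField) (src tgt : J → I) (ht : I → ℝ) where
  vtx : I → R.carrier
  toFun_vtx : ∀ i, R.toFun (vtx i) = ht i
  γ : J → ℝ → R.carrier
  continuous_γ : ∀ e, Continuous (γ e)
  lt : ∀ e, ht (src e) < ht (tgt e)
  toFun_γ : ∀ e, ∀ t ∈ Set.Icc (ht (src e)) (ht (tgt e)), R.toFun (γ e t) = t
  γ_src : ∀ e, γ e (ht (src e)) = vtx (src e)
  γ_tgt : ∀ e, γ e (ht (tgt e)) = vtx (tgt e)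
  isOpen_edge : ∀ e, IsOpen (γ e '' Set.Ioo (ht (src e)) (ht (tgt e)))
  eq_of_γ_eq : ∀ e e' t, t ∈ Set.Ioo (ht (src e)) (ht (tgt e)) →
    t ∈ Set.Ioo (ht (src e')) (ht (tgt e')) → γ e t = γ e' t → e = e'
  vtx_mem : ∀ i, vtx i ∈ R.vertices
  cover : ∀ x, (∃ i, x = vtx i) ∨ ∃ e, x ∈ γ e '' Set.Ioo (ht (src e)) (ht (tgt e))

namespace EdgeModel

variable {I J : Type} {R R' : ScalarField} {src tgt : J → I} {ht : I → ℝ}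

theorem nonempty_of_isomorphic (M : EdgeModel R src tgt ht) (h : R.Isomorphic R') :
    Nonempty (EdgeModel R' src tgt ht) := by
  obtain ⟨h, hh⟩ := h
  exact ⟨{
    vtx := fun i => h (M.vtx i)
    toFun_vtx := fun i => by rw [hh, M.toFun_vtx]
    γ := fun e t => h (M.γ e t)
    continuous_γ := fun e => h.continuous.comp (M.continuous_γ e)
    lt := M.lt
    toFun_γ := fun e t ht => by rw [hh, M.toFun_γ e t ht]
    γ_src := fun e => by rw [M.γ_src]
    γ_tgt := fun e => by rw [M.γ_tgt]
    isOpen_edge := fun e => by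
      rw [← Set.image_image h (M.γ e)]
      exact h.isOpenMap _ (M.isOpen_edge e)
    eq_of_γ_eq := fun e e' t ht ht' heq => M.eq_of_γ_eq e e' t ht ht' (h.injective heq)
    vtx_mem := fun i => ScalarField.apply_mem_vertices h hh (M.vtx_mem i)
    cover := fun x => by
      rcases M.cover (h.symm x) with ⟨i, hi⟩ | ⟨e, t, ht, he⟩
      · exact Or.inl ⟨i, by rw [← hi, h.apply_symm_apply]⟩
      · exact Or.inr ⟨e, t, ht, (congrArg h he).trans (h.apply_symm_apply x)⟩ }⟩

variable (M : EdgeModel R src tgt ht)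
include M

/-- The open edges. -/
def edge (e : J) : Set R.carrier := M.γ e '' Set.Ioo (ht (src e)) (ht (tgt e))

/-- The open edge itself is a chart, with inverse `γ e`. -/
theorem notMem_vertices_of_mem_edge {x : R.carrier} {e : J} (hx : x ∈ M.edge e) :
    x ∉ R.vertices := by
  refine fun hv => hv ⟨M.edge e, M.isOpen_edge e, hx, ?_⟩
  have hf (t : ℝ) (h : t ∈ Set.Ioo (ht (src e)) (ht (tgt e))) : R.toFun (M.γ e t) = t :=
    M.toFun_γ e t (Set.Ioo_subset_Icc_self h)
  refine IsOpenEmbedding.of_continuous_injective_isOpenMap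
    (R.continuous_toFun.comp continuous_subtype_val) ?_ ?_
  · rintro ⟨_, t, h, rfl⟩ ⟨_, t', h', rfl⟩ heq
    dsimp only at heq
    rw [hf t h, hf t' h'] at heq
    subst heq
    rfl
  · rintro _ ⟨V, hV, rfl⟩
    have : (fun y : M.edge e => R.toFun y) '' (Subtype.val ⁻¹' V) =
        Set.Ioo (ht (src e)) (ht (tgt e)) ∩ M.γ e ⁻¹' V := by
      ext t
      constructor
      · rintro ⟨⟨_, s, h, rfl⟩, hV, rfl⟩
        dsimp only
        rw [hf s h]
        exact ⟨h, hV⟩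
      · rintro ⟨h, hV⟩
        exact ⟨⟨_, t, h, rfl⟩, hV, hf t h⟩
    rw [this]
    exact isOpen_Ioo.inter (hV.preimage (M.continuous_γ e))

theorem vertices_eq : R.vertices = Set.range M.vtx := by
  ext x
  constructor
  · intro hx
    rcases M.cover x with ⟨i, rfl⟩ | ⟨e, he⟩
    · exact ⟨i, rfl⟩
    · exact (M.notMem_vertices_of_mem_edge he hx).elim
  · rintro ⟨i, rfl⟩
    exact M.vtx_mem i

theorem criticalValues_eq : R.criticalValues = Set.range ht := by
  rw [ScalarField.criticalValues, M.vertices_eq, ← Set.range_comp]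
  congr 1
  funext i
  exact M.toFun_vtx i

theorem injOn_vertices (hinj : Function.Injective ht) : Set.InjOn R.toFun R.vertices := by
  rw [M.vertices_eq]
  rintro _ ⟨i, rfl⟩ _ ⟨j, rfl⟩ h
  rw [M.toFun_vtx, M.toFun_vtx] at h
  rw [hinj h]

theorem vtx_injective (hinj : Function.Injective ht) : Function.Injective M.vtx := by
  intro i j h
  have := congrArg R.toFun h
  rw [M.toFun_vtx, M.toFun_vtx] at this
  exact hinj this

theorem exists_mem_edge {x : R.carrier} (hx : x ∈ R.verticesᶜ) : ∃ e, x ∈ M.edge e := by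
  rcases M.cover x with ⟨i, rfl⟩ | h
  · exact (hx (M.vtx_mem i)).elim
  · exact h

theorem eq_of_mem_edge {x : R.carrier} {e e' : J} (h : x ∈ M.edge e) (h' : x ∈ M.edge e') :
    e = e' := by
  obtain ⟨t, ht, rfl⟩ := h
  obtain ⟨t', ht', heq⟩ := h'
  have := congrArg R.toFun heq
  rw [M.toFun_γ e t (Set.Ioo_subset_Icc_self ht),
    M.toFun_γ e' t' (Set.Ioo_subset_Icc_self ht')] at this
  subst this
  exact M.eq_of_γ_eq _ _ _ ht ht' heq.symm

theorem nonempty_edge (e : J) : (M.edge e).Nonempty :=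
  (Set.nonempty_Ioo.2 (M.lt e)).image _

theorem edge_injective : Function.Injective M.edge := by
  intro e e' h
  obtain ⟨x, hx⟩ := M.nonempty_edge e
  exact M.eq_of_mem_edge hx (h ▸ hx)

/-- The edges are connected, open and pairwise disjoint, and they cover the complement of the
vertices. -/
theorem connectedComponentIn_eq_edge {x : R.carrier} {e : J} (hx : x ∈ M.edge e) :
    connectedComponentIn R.verticesᶜ x = M.edge e := by
  refine Set.Subset.antisymm ?_ ?_
  · refine isPreconnected_connectedComponentIn.subset_left_of_subset_union (M.isOpen_edge e)
      (v := ⋃ e' : {e' // e' ≠ e}, M.edge e') (isOpen_iUnion fun e' => M.isOpen_edge e') ?_ ?_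
      ⟨x, mem_connectedComponentIn (M.notMem_vertices_of_mem_edge hx), hx⟩
    · rw [Set.disjoint_left]
      intro y hy hy'
      obtain ⟨⟨e', hne⟩, hy'⟩ := Set.mem_iUnion.1 hy'
      exact hne (M.eq_of_mem_edge hy' hy)
    · intro y hy
      obtain ⟨e', he'⟩ := M.exists_mem_edge (connectedComponentIn_subset _ _ hy)
      by_cases h : e' = e
      · exact Or.inl (h ▸ he')
      · exact Or.inr (Set.mem_iUnion.2 ⟨⟨e', h⟩, he'⟩)
  · exact (isPreconnected_Ioo.image _ (M.continuous_γ e).continuousOn).subset_connectedComponentIn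
      hx fun y hy => M.notMem_vertices_of_mem_edge hy

theorem closure_edge_inter [T2Space R.carrier] (e : J) :
    closure (M.edge e) ∩ R.vertices = {M.vtx (src e), M.vtx (tgt e)} := by
  have hcl : closure (M.edge e) = M.γ e '' Set.Icc (ht (src e)) (ht (tgt e)) := by
    refine Set.Subset.antisymm ?_ ?_
    · exact closure_minimal (Set.image_mono Set.Ioo_subset_Icc_self)
        (isCompact_Icc.image (M.continuous_γ e)).isClosed
    · rw [← closure_Ioo (M.lt e).ne]
      exact image_closure_subset_closure_image (M.continuous_γ e)
  rw [hcl]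
  ext x
  constructor
  · rintro ⟨⟨t, h, rfl⟩, hv⟩
    rcases h.1.eq_or_lt with h1 | h1
    · exact Or.inl (by rw [← h1, M.γ_src])
    rcases h.2.eq_or_lt with h2 | h2
    · exact Or.inr (by rw [h2, M.γ_tgt]; rfl)
    · exact (M.notMem_vertices_of_mem_edge ⟨t, ⟨h1, h2⟩, rfl⟩ hv).elim
  · rintro (rfl | rfl)
    · exact ⟨⟨_, Set.left_mem_Icc.2 (M.lt e).le, M.γ_src e⟩, M.vtx_mem _⟩
    · exact ⟨⟨_, Set.right_mem_Icc.2 (M.lt e).le, M.γ_tgt e⟩, M.vtx_mem _⟩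

theorem isLink_edge_iff [T2Space R.carrier] (e : J) (x y : R.carrier) :
    R.multigraph.IsLink (M.edge e) x y ↔
      ({M.vtx (src e), M.vtx (tgt e)} : Set R.carrier) = {x, y} := by
  rw [← M.closure_edge_inter e]
  refine ⟨fun h => h.2, fun h => ⟨?_, h⟩⟩
  obtain ⟨p, hp⟩ := M.nonempty_edge e
  exact ⟨p, M.notMem_vertices_of_mem_edge hp, (M.connectedComponentIn_eq_edge hp).symm⟩

theorem edgeSet_eq [T2Space R.carrier] : R.multigraph.edgeSet = Set.range M.edge := by
  ext s
  rw [Graph.edge_mem_iff_exists_isLink]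
  constructor
  · rintro ⟨x, y, ⟨p, hp, rfl⟩, -⟩
    obtain ⟨e, he⟩ := M.exists_mem_edge hp
    exact ⟨e, (M.connectedComponentIn_eq_edge he).symm⟩
  · rintro ⟨e, rfl⟩
    exact ⟨_, _, (M.isLink_edge_iff e _ _).2 rfl⟩

/-- The vertices of the multigraph are indexed by `I`. -/
noncomputable def vertexEquiv (hinj : Function.Injective ht) : I ≃ R.multigraph.vertexSet :=
  (Equiv.ofInjective _ (M.vtx_injective hinj)).trans (Equiv.setCongr M.vertices_eq.symm)

/-- The edges of the multigraph are indexed by `J`. -/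
noncomputable def edgeEquiv [T2Space R.carrier] : J ≃ R.multigraph.edgeSet :=
  (Equiv.ofInjective _ M.edge_injective).trans (Equiv.setCongr M.edgeSet_eq.symm)

theorem isLink_equiv_iff [T2Space R.carrier] (hinj : Function.Injective ht) (e : J) (i j : I) :
    R.multigraph.IsLink (M.edgeEquiv e) (M.vertexEquiv hinj i) (M.vertexEquiv hinj j) ↔
      ({src e, tgt e} : Set I) = {i, j} := by
  rw [← (M.vtx_injective hinj).image_injective.eq_iff, Set.image_pair, Set.image_pair]
  exact M.isLink_edge_iff e _ _

/-- Incidence is expressed by `src` and `tgt` alone, so the two height functions may differ. -/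
theorem multigraph_isomorphic {ht' : I → ℝ} (M' : EdgeModel R' src tgt ht') [T2Space R.carrier]
    [T2Space R'.carrier] (hinj : Function.Injective ht) (hinj' : Function.Injective ht') :
    R.multigraph.Isomorphic R'.multigraph := by
  refine ⟨(M.vertexEquiv hinj).symm.trans (M'.vertexEquiv hinj'),
    M.edgeEquiv.symm.trans M'.edgeEquiv, fun e v w => ?_⟩
  obtain ⟨e, rfl⟩ := M.edgeEquiv.surjective e
  obtain ⟨i, rfl⟩ := (M.vertexEquiv hinj).surjective v
  obtain ⟨j, rfl⟩ := (M.vertexEquiv hinj).surjective w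
  simp only [Equiv.trans_apply, Equiv.symm_apply_apply]
  rw [M.isLink_equiv_iff, M'.isLink_equiv_iff]

end EdgeModel

end EdgeModels

/-! ### The planar trees as one-dimensional complexes -/

namespace PlanarTree

/-- The strand of each edge. -/
def edgeStrand : Fin 5 → Fin 3 := ![0, 1, 0, 2, 0]

/-- The lower vertex of each edge. -/
def edgeSrc : Fin 5 → Fin 6 := ![0, 1, 3, 2, 4]

/-- The upper vertex of each edge. -/
def edgeTgt : Fin 5 → Fin 6 := ![3, 3, 4, 4, 5]

/-- The strand of each vertex. -/
def vertexStrand : Fin 6 → Fin 3 := ![0, 1, 2, 0, 0, 0]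

variable (σ : Equiv.Perm (Fin 3))

/-- The height of each vertex. -/
def vertexHeight : Fin 6 → ℕ := ![σ 0, σ 1, σ 2, 3, 4, 5]

variable {σ}

theorem vertexHeight_injective : Function.Injective fun i => (vertexHeight σ i : ℝ) := by
  refine Nat.cast_injective.comp ?_
  decide +revert

theorem range_vertexHeight :
    (Set.range fun i => (vertexHeight σ i : ℝ)) = {0, 1, 2, 3, 4, 5} := by
  have h1 : ∀ n : Fin 6, ∃ i, vertexHeight σ i = n := by decide +revert
  have h2 : ∀ i, vertexHeight σ i < 6 := by decide +revert
  ext r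
  simp only [Set.mem_range, Set.mem_insert_iff, Set.mem_singleton_iff]
  constructor
  · rintro ⟨i, rfl⟩
    have := h2 i
    interval_cases vertexHeight σ i <;> norm_num
  · have key (n : Fin 6) (h : r = (n : ℕ)) : ∃ i, (vertexHeight σ i : ℝ) = r := by
      obtain ⟨i, hi⟩ := h1 n
      exact ⟨i, by rw [hi, h]⟩
    rintro (rfl | rfl | rfl | rfl | rfl | rfl)
    exacts [key 0 (by simp), key 1 (by simp), key 2 (by simp), key 3 (by simp), key 4 (by simp),
      key 5 (by simp)]

theorem base_le_vertexHeight_src (e : Fin 5) :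
    ((σ (edgeStrand e) : ℕ) : ℝ) ≤ vertexHeight σ (edgeSrc e) := by
  have : (σ (edgeStrand e) : ℕ) ≤ vertexHeight σ (edgeSrc e) := by decide +revert
  exact_mod_cast this

theorem base_le_vertexHeight (i : Fin 6) :
    ((σ (vertexStrand i) : ℕ) : ℝ) ≤ vertexHeight σ i := by
  have : (σ (vertexStrand i) : ℕ) ≤ vertexHeight σ i := by decide +revert
  exact_mod_cast this

theorem vertexHeight_le_five (i : Fin 6) : (vertexHeight σ i : ℝ) ≤ 5 := by
  have : vertexHeight σ i ≤ 5 := by decide +revert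
  exact_mod_cast this

theorem vertexHeight_src_lt (e : Fin 5) :
    (vertexHeight σ (edgeSrc e) : ℝ) < vertexHeight σ (edgeTgt e) := by
  have : vertexHeight σ (edgeSrc e) < vertexHeight σ (edgeTgt e) := by decide +revert
  exact_mod_cast this

variable (σ) in
/-- The vertices of the planar tree. -/
noncomputable def vertex (i : Fin 6) : (tree σ).carrier :=
  point σ (vertexStrand i) (vertexHeight σ i)

variable (σ) in
/-- The height interval of an open edge. -/
abbrev edgeInterval (e : Fin 5) : Set ℝ :=
  Set.Ioo (vertexHeight σ (edgeSrc e) : ℝ) (vertexHeight σ (edgeTgt e))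

theorem point_val_of_mem {e : Fin 5} {t : ℝ} (h : t ∈ edgeInterval σ e) :
    (point σ (edgeStrand e) t).1 = (strand (edgeStrand e) t, t) :=
  point_val ((base_le_vertexHeight_src e).trans h.1.le) (h.2.le.trans (vertexHeight_le_five _))

theorem eq_point {j : Fin 3} {z : (tree σ).carrier} (hj : ((σ j : ℕ) : ℝ) ≤ z.1.2)
    (h : z.1.1 = strand j z.1.2) : z = point σ j z.1.2 :=
  Subtype.ext (by rw [point_val hj z.2.1, ← h])

/-- The hypotheses exclude strands 1 and 2 below their merging heights; from there on they coincide
with strand 0. -/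
theorem eq_point_zero {z : (tree σ).carrier} (h1 : z.1.1 < 3 - z.1.2 ∨ 3 ≤ z.1.2)
    (h2 : z.1.2 - 4 < z.1.1 ∨ 4 ≤ z.1.2) (h0 : ((σ 0 : ℕ) : ℝ) ≤ 3) :
    ((σ 0 : ℕ) : ℝ) ≤ z.1.2 ∧ z = point σ 0 z.1.2 := by
  have key : ((σ 0 : ℕ) : ℝ) ≤ z.1.2 ∧ z.1.1 = strand 0 z.1.2 := by
    obtain ⟨j, hj, hx⟩ := z.2.2
    by_cases h3 : 3 ≤ z.1.2
    · refine ⟨h0.trans h3, hx.trans ?_⟩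
      by_cases h4 : 4 ≤ z.1.2
      · exact strand_eq_of_four_le h4 _ _
      · fin_cases j
        · rfl
        · exact (strand_eq_of_three_le h3).symm
        · have hx' : z.1.1 = -max 0 (4 - z.1.2) := hx
          have := h2.resolve_right h4
          linarith [le_max_right 0 (4 - z.1.2)]
    · have := h1.resolve_right h3
      have := h2.resolve_right (by linarith)
      fin_cases j
      · exact ⟨hj, hx⟩
      · have hx' : z.1.1 = max 0 (3 - z.1.2) := hx
        linarith [le_max_right 0 (3 - z.1.2)]
      · have hx' : z.1.1 = -max 0 (4 - z.1.2) := hx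
        linarith [le_max_right 0 (4 - z.1.2)]
  exact ⟨key.1, eq_point key.1 key.2⟩

theorem eq_point_one {z : (tree σ).carrier} (h : 0 < z.1.1) :
    ((σ 1 : ℕ) : ℝ) ≤ z.1.2 ∧ z.1.2 < 3 ∧ z = point σ 1 z.1.2 := by
  obtain ⟨j, hj, hx⟩ := z.2.2
  fin_cases j
  · exact (h.ne' hx).elim
  · refine ⟨hj, ?_, eq_point hj hx⟩
    have hx' : z.1.1 = max 0 (3 - z.1.2) := hx
    rw [hx', lt_max_iff] at h
    linarith [h.resolve_left (lt_irrefl 0)]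
  · have hx' : z.1.1 = -max 0 (4 - z.1.2) := hx
    linarith [le_max_left 0 (4 - z.1.2)]

theorem eq_point_two {z : (tree σ).carrier} (h : z.1.1 < 0) :
    ((σ 2 : ℕ) : ℝ) ≤ z.1.2 ∧ z.1.2 < 4 ∧ z = point σ 2 z.1.2 := by
  obtain ⟨j, hj, hx⟩ := z.2.2
  fin_cases j
  · exact (h.ne hx).elim
  · have hx' : z.1.1 = max 0 (3 - z.1.2) := hx
    linarith [le_max_left 0 (3 - z.1.2)]
  · refine ⟨hj, ?_, eq_point hj hx⟩
    have hx' : z.1.1 = -max 0 (4 - z.1.2) := hx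
    rw [hx', neg_lt_zero, lt_max_iff] at h
    linarith [h.resolve_left (lt_irrefl 0)]

theorem mem_edge_iff {e : Fin 5} {z : (tree σ).carrier} :
    z ∈ point σ (edgeStrand e) '' edgeInterval σ e ↔
      z.1.2 ∈ edgeInterval σ e ∧ z = point σ (edgeStrand e) z.1.2 := by
  constructor
  · rintro ⟨t, h, rfl⟩
    rw [point_val_of_mem h]
    exact ⟨h, rfl⟩
  · rintro ⟨h, hz⟩
    exact ⟨_, h, hz.symm⟩

/-- Within its range of heights, each edge is cut out by strict inequalities on the abscissa. -/
theorem isOpen_edge (e : Fin 5) :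
    IsOpen (point σ (edgeStrand e) '' edgeInterval σ e) := by
  have h03 : ((σ 0 : ℕ) : ℝ) ≤ 3 := (base_le_two 0).trans (by norm_num)
  have hI : IsOpen {z : (tree σ).carrier | z.1.2 ∈ edgeInterval σ e} :=
    isOpen_Ioo.preimage continuous_height
  have key (V : Set (tree σ).carrier) (hV : IsOpen V)
      (h1 : ∀ z ∈ V, z.1.2 ∈ edgeInterval σ e → z = point σ (edgeStrand e) z.1.2)
      (h2 : ∀ t ∈ edgeInterval σ e, point σ (edgeStrand e) t ∈ V) :
      IsOpen (point σ (edgeStrand e) '' edgeInterval σ e) := by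
    convert hV.inter hI using 1
    ext z
    rw [mem_edge_iff]
    exact ⟨fun h => ⟨by rw [h.2]; exact h2 _ h.1, h.1⟩, fun h => ⟨h.2, h1 z h.1 h.2⟩⟩
  have o1 : IsOpen {z : (tree σ).carrier | z.1.1 < 3 - z.1.2} :=
    isOpen_lt continuous_abscissa (continuous_const.sub continuous_height)
  have o2 : IsOpen {z : (tree σ).carrier | z.1.2 - 4 < z.1.1} :=
    isOpen_lt (continuous_height.sub continuous_const) continuous_abscissa
  have hv (t : ℝ) (h : t ∈ edgeInterval σ e) := point_val_of_mem h
  fin_cases e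
  · refine key _ (o1.inter o2) (fun z hz _ => (eq_point_zero (Or.inl hz.1) (Or.inl hz.2) h03).2)
      fun t h => ?_
    have h3 : t < ((3 : ℕ) : ℝ) := h.2
    norm_num at h3
    change (point σ _ t).1.1 < 3 - (point σ _ t).1.2 ∧ (point σ _ t).1.2 - 4 < (point σ _ t).1.1
    rw [hv t h]
    change (0 : ℝ) < 3 - t ∧ t - 4 < 0
    constructor <;> linarith
  · refine key {z | 0 < z.1.1} (isOpen_lt continuous_const continuous_abscissa)
      (fun z hz _ => (eq_point_one hz).2.2) fun t h => ?_
    have h3 : t < ((3 : ℕ) : ℝ) := h.2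
    norm_num at h3
    change 0 < (point σ _ t).1.1
    rw [hv t h]
    exact lt_max_of_lt_right (by linarith)
  · refine key _ o2 (fun z hz h => ?_) fun t h => ?_
    · have h3 : ((3 : ℕ) : ℝ) < z.1.2 := h.1
      norm_num at h3
      exact (eq_point_zero (Or.inr h3.le) (Or.inl hz) h03).2
    · have h4 : t < ((4 : ℕ) : ℝ) := h.2
      norm_num at h4
      change (point σ _ t).1.2 - 4 < (point σ _ t).1.1
      rw [hv t h]
      change t - 4 < 0
      linarith
  · refine key {z | z.1.1 < 0} (isOpen_lt continuous_abscissa continuous_const)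
      (fun z hz _ => (eq_point_two hz).2.2) fun t h => ?_
    have h4 : t < ((4 : ℕ) : ℝ) := h.2
    norm_num at h4
    change (point σ _ t).1.1 < 0
    rw [hv t h]
    exact neg_lt_zero.2 (lt_max_of_lt_right (by linarith))
  · refine key _ isOpen_univ (fun z _ h => ?_) fun t h => trivial
    have h4 : ((4 : ℕ) : ℝ) < z.1.2 := h.1
    norm_num at h4
    exact (eq_point_zero (Or.inr (by linarith)) (Or.inr h4.le) h03).2

theorem edge_disjoint (e e' : Fin 5) (t : ℝ) (h : t ∈ edgeInterval σ e)
    (h' : t ∈ edgeInterval σ e') (heq : point σ (edgeStrand e) t = point σ (edgeStrand e') t) :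
    e = e' := by
  have hs := congrArg (fun z => z.1.1) heq
  rw [point_val_of_mem h, point_val_of_mem h'] at hs
  dsimp only at hs
  have := h.1
  have := h.2
  have := h'.1
  have := h'.2
  fin_cases e <;> fin_cases e' <;> first
    | rfl
    | (exfalso
       simp [edgeSrc, edgeTgt, edgeStrand, vertexHeight] at *
       linarith [le_max_right 0 (3 - t), le_max_right 0 (4 - t), le_max_left 0 (3 - t),
         le_max_left 0 (4 - t)])

theorem isLocalExtr_leaf (j : Fin 3) :
    IsLocalExtr (tree σ).toFun (point σ j (σ j : ℕ)) := by
  have h2 := base_le_two (σ := σ) j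
  have hv : (point σ j (σ j : ℕ)).1 = (strand j (σ j : ℕ), ((σ j : ℕ) : ℝ)) :=
    point_val le_rfl (h2.trans (by norm_num))
  have key (V : Set (tree σ).carrier) (hV : IsOpen V) (hm : point σ j (σ j : ℕ) ∈ V)
      (hle : ∀ z ∈ V, ((σ j : ℕ) : ℝ) ≤ z.1.2) :
      IsLocalExtr (tree σ).toFun (point σ j (σ j : ℕ)) := by
    left
    filter_upwards [hV.mem_nhds hm] with z hz
    exact (toFun_point le_rfl (h2.trans (by norm_num))).trans_le (hle z hz)
  fin_cases j
  · refine key {z | z.1.1 < 3 - z.1.2 ∧ z.1.2 - 4 < z.1.1}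
      ((isOpen_lt continuous_abscissa (continuous_const.sub continuous_height)).inter
      (isOpen_lt (continuous_height.sub continuous_const) continuous_abscissa)) ?_
      fun z hz => (eq_point_zero (Or.inl hz.1) (Or.inl hz.2) (h2.trans (by norm_num))).1
    change (point σ _ _).1.1 < 3 - (point σ _ _).1.2 ∧ (point σ _ _).1.2 - 4 < (point σ _ _).1.1
    rw [hv]
    change (0 : ℝ) < 3 - (σ 0 : ℕ) ∧ ((σ 0 : ℕ) : ℝ) - 4 < 0
    have h2' : ((σ 0 : ℕ) : ℝ) ≤ 2 := h2
    constructor <;> linarith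
  · refine key {z | 0 < z.1.1} (isOpen_lt continuous_const continuous_abscissa) ?_
      fun z hz => (eq_point_one hz).1
    change 0 < (point σ _ _).1.1
    rw [hv]
    have h2' : ((σ 1 : ℕ) : ℝ) ≤ 2 := h2
    exact lt_max_of_lt_right (show (0 : ℝ) < 3 - (σ 1 : ℕ) by linarith)
  · refine key {z | z.1.1 < 0} (isOpen_lt continuous_abscissa continuous_const) ?_
      fun z hz => (eq_point_two hz).1
    change (point σ _ _).1.1 < 0
    rw [hv]
    have h2' : ((σ 2 : ℕ) : ℝ) ≤ 2 := h2
    exact neg_lt_zero.2 (lt_max_of_lt_right (show (0 : ℝ) < 4 - (σ 2 : ℕ) by linarith))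

theorem vertex_mem (i : Fin 6) : vertex σ i ∈ (tree σ).vertices := by
  have h2 := base_le_two (σ := σ)
  have merge (j : Fin 3) (b : ℝ) (h3 : 3 ≤ b) (h5 : b ≤ 5) (hb : strand j b = 0)
      (hne : ∀ t < b, strand j t ≠ 0) : point σ 0 b ∈ (tree σ).vertices := by
    -- All strands have started by height 2, whence the choice of `a`.
    refine ScalarField.mem_vertices_of_merge (continuous_point σ 0) (continuous_point σ j)
      (a := 2) (b := b) (by linarith) (fun t h => toFun_point ((h2 0).trans h.1.le) (h.2.le.trans h5))
      (fun t h => toFun_point ((h2 j).trans h.1.le) (h.2.le.trans h5))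
      (point_eq_point ((h2 0).trans (by linarith)) ((h2 j).trans (by linarith)) h5 hb.symm)
      fun t h heq => hne t h.2 ?_
    have := congrArg (fun z => z.1.1) heq
    rw [point_val ((h2 0).trans h.1.le) (h.2.le.trans h5),
      point_val ((h2 j).trans h.1.le) (h.2.le.trans h5)] at this
    exact this.symm
  fin_cases i
  · exact ScalarField.mem_vertices_of_isLocalExtr (isLocalExtr_leaf 0)
  · exact ScalarField.mem_vertices_of_isLocalExtr (isLocalExtr_leaf 1)
  · exact ScalarField.mem_vertices_of_isLocalExtr (isLocalExtr_leaf 2)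
  · refine merge 1 (3 : ℕ) (by norm_num) (by norm_num) (by norm_num) fun t h => ?_
    norm_num at h
    exact (lt_max_of_lt_right (show 0 < 3 - t by linarith)).ne'
  · refine merge 2 (4 : ℕ) (by norm_num) (by norm_num) (by norm_num) fun t h => ?_
    norm_num at h
    exact (neg_lt_zero.2 (lt_max_of_lt_right (show 0 < 4 - t by linarith))).ne
  · refine ScalarField.mem_vertices_of_isLocalExtr (Or.inr (Filter.Eventually.of_forall fun z => ?_))
    have h : (tree σ).toFun (point σ 0 ((5 : ℕ) : ℝ)) = ((5 : ℕ) : ℝ) :=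
      toFun_point ((h2 0).trans (by norm_num)) (by norm_num)
    refine (toFun_le_five z).trans ?_
    change (5 : ℝ) ≤ (tree σ).toFun (point σ 0 ((5 : ℕ) : ℝ))
    rw [h]
    norm_num

theorem edge_cover (z : (tree σ).carrier) :
    (∃ i, z = vertex σ i) ∨ ∃ e, z ∈ point σ (edgeStrand e) '' edgeInterval σ e := by
  have h03 : ((σ 0 : ℕ) : ℝ) ≤ 3 := (base_le_two 0).trans (by norm_num)
  have e3 : ((3 : ℕ) : ℝ) = 3 := by norm_num
  have e4 : ((4 : ℕ) : ℝ) = 4 := by norm_num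
  have e5 : ((5 : ℕ) : ℝ) = 5 := by norm_num
  have hvx (i : Fin 6) (h : z = point σ (vertexStrand i) z.1.2)
      (ht : z.1.2 = vertexHeight σ i) : z = vertex σ i := by
    rw [vertex, ← ht]
    exact h
  have zero (hz : z = point σ 0 z.1.2) (h0 : ((σ 0 : ℕ) : ℝ) ≤ z.1.2) :
      (∃ i, z = vertex σ i) ∨ ∃ e, z ∈ point σ (edgeStrand e) '' edgeInterval σ e := by
    rcases h0.eq_or_lt with h | h0
    · exact Or.inl ⟨0, hvx 0 hz h.symm⟩
    rcases lt_trichotomy z.1.2 ((3 : ℕ) : ℝ) with h | h | h3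
    · exact Or.inr ⟨0, mem_edge_iff.2 ⟨⟨h0, h⟩, hz⟩⟩
    · exact Or.inl ⟨3, hvx 3 hz h⟩
    rcases lt_trichotomy z.1.2 ((4 : ℕ) : ℝ) with h | h | h4
    · exact Or.inr ⟨2, mem_edge_iff.2 ⟨⟨h3, h⟩, hz⟩⟩
    · exact Or.inl ⟨4, hvx 4 hz h⟩
    rcases (z.2.1.trans_eq e5.symm).lt_or_eq with h | h
    · exact Or.inr ⟨4, mem_edge_iff.2 ⟨⟨h4, h⟩, hz⟩⟩
    · exact Or.inl ⟨5, hvx 5 hz h⟩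
  rcases lt_trichotomy 0 z.1.1 with h | h | h
  · obtain ⟨h1, h3, hz⟩ := eq_point_one h
    rcases h1.eq_or_lt with h | h1
    · exact Or.inl ⟨1, hvx 1 hz h.symm⟩
    · exact Or.inr ⟨1, mem_edge_iff.2 ⟨⟨h1, h3.trans_eq e3.symm⟩, hz⟩⟩
  · obtain ⟨h0, hz⟩ := eq_point_zero (σ := σ) (z := z) (by
      rw [← h]
      rcases lt_or_ge z.1.2 3 with h | h
      · left; linarith
      · exact Or.inr h) (by
      rw [← h]
      rcases lt_or_ge z.1.2 4 with h | h
      · left; linarith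
      · exact Or.inr h) h03
    exact zero hz h0
  · obtain ⟨h1, h3, hz⟩ := eq_point_two h
    rcases h1.eq_or_lt with h | h1
    · exact Or.inl ⟨2, hvx 2 hz h.symm⟩
    · exact Or.inr ⟨3, mem_edge_iff.2 ⟨⟨h1, h3.trans_eq e4.symm⟩, hz⟩⟩

variable (σ) in
/-- The planar tree as a one-dimensional complex. -/
noncomputable def edgeModel :
    EdgeModel (tree σ) edgeSrc edgeTgt fun i => (vertexHeight σ i : ℝ) where
  vtx := vertex σ
  toFun_vtx i := toFun_point (base_le_vertexHeight i) (vertexHeight_le_five i)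
  γ e := point σ (edgeStrand e)
  continuous_γ e := continuous_point σ _
  lt := vertexHeight_src_lt
  toFun_γ := fun e _ h => toFun_point ((base_le_vertexHeight_src e).trans h.1)
    (h.2.trans (vertexHeight_le_five _))
  γ_src := fun e => by fin_cases e <;> rfl
  γ_tgt := fun e => by
    have h3 : point σ 1 ((3 : ℕ) : ℝ) = point σ 0 ((3 : ℕ) : ℝ) :=
      point_eq_point ((base_le_two _).trans (by norm_num)) ((base_le_two _).trans (by norm_num))
        (by norm_num) (strand_eq_of_three_le (by norm_num)).symm
    have h4 : point σ 2 ((4 : ℕ) : ℝ) = point σ 0 ((4 : ℕ) : ℝ) :=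
      point_eq_point ((base_le_two _).trans (by norm_num)) ((base_le_two _).trans (by norm_num))
        (by norm_num) (strand_eq_of_four_le (by norm_num) _ _)
    fin_cases e
    exacts [rfl, h3, rfl, h4, rfl]
  isOpen_edge := isOpen_edge
  eq_of_γ_eq := edge_disjoint
  vtx_mem := vertex_mem
  cover := edge_cover

/-! ### The two trees are not isomorphic -/

/-- Strands 0 and 1 meet at height 3, hence within the part below height 4. -/
theorem joinedIn_zero_one {σ : Equiv.Perm (Fin 3)} (hσ : σ 1 = 2) (j : Fin 2) {t : ℝ}
    (h0 : ((σ j.castSucc : ℕ) : ℝ) ≤ t) (ht : t ≤ 3) :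
    JoinedIn ((tree σ).toFun ⁻¹' Set.Iio 4) (point σ j.castSucc t) (point σ 0 3) := by
  have h2 := base_le_two (σ := σ)
  have h := (threeLeafTree σ hσ).joinedIn_push (a := 3) (s := 3) (x := point σ j.castSucc t)
    ((toFun_point h0 (by linarith)).trans_le ht) le_rfl (by norm_num)
  have hp : (threeLeafTree σ hσ).push 3 (point σ j.castSucc t) = point σ 0 3 := by
    refine (push_point h0 ht (by norm_num)).trans ?_
    refine point_eq_point ((h2 _).trans (by norm_num)) ((h2 _).trans (by norm_num))
      (by norm_num) ?_
    fin_cases j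
    · rfl
    · exact (strand_eq_of_three_le le_rfl).symm
  rw [hp] at h
  exact h.mono (Set.preimage_mono (Set.Iic_subset_Iio.2 (by norm_num)))

theorem not_isomorphic {σ τ : Equiv.Perm (Fin 3)} (hσ : σ 1 = 2)
    (hσ0 : σ 0 = 0) (hτ2 : τ 2 = 0) : ¬ (tree σ).Isomorphic (tree τ) := by
  rintro ⟨h, hh⟩
  have b0 : ((σ 0 : ℕ) : ℝ) = 0 := by rw [hσ0]; norm_num
  have b1 : ((σ 1 : ℕ) : ℝ) = 2 := by rw [hσ]; norm_num
  -- The only point of the second tree at height 0 is the bottom of strand 2.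
  have hlow : (tree τ).toFun (h (point σ 0 0)) = 0 := by
    rw [hh, toFun_point b0.le (by norm_num)]
  have hneg : (h (point σ 0 0)).1.1 < 0 := by
    obtain ⟨j, hj, hz⟩ := exists_point (h (point σ 0 0))
    rw [hlow] at hj hz
    have hj0 : (τ j : ℕ) = 0 := Nat.le_zero.1 (by exact_mod_cast hj)
    have hj2 : j = 2 := τ.injective (by rw [hτ2]; exact Fin.ext hj0)
    rw [hz, point_val hj (by norm_num), hj2]
    norm_num
  -- The height 5/2 lies above all leaves and below the first merge. Strands 0 and 1 of the first
  -- tree have distinct points there, both joined to the lowest point below height 4; their images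
  -- must lie on strand 2, which has only one point at that height.
  have key (j : Fin 2) (hj : ((σ j.castSucc : ℕ) : ℝ) ≤ 5 / 2) :
      h (point σ j.castSucc (5 / 2)) = point τ 2 (5 / 2) := by
    have hJ : JoinedIn ((tree σ).toFun ⁻¹' Set.Iio 4) (point σ 0 0)
        (point σ j.castSucc (5 / 2)) :=
      (joinedIn_zero_one hσ 0 b0.le (by norm_num)).trans
        (joinedIn_zero_one hσ j hj (by norm_num)).symm
    have hJ' : JoinedIn ((tree τ).toFun ⁻¹' Set.Iio 4) (h (point σ 0 0))
        (h (point σ j.castSucc (5 / 2))) := by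
      obtain ⟨γ, hγ⟩ := hJ
      refine ⟨γ.map h.continuous, fun t => ?_⟩
      change (tree τ).toFun (h (γ t)) < 4
      rw [hh]
      exact hγ t
    have hn : (h (point σ j.castSucc (5 / 2))).1.1 < 0 :=
      lt_of_not_ge fun hge => not_joinedIn_of_neg hneg hge hJ'
    have hht : (h (point σ j.castSucc (5 / 2))).1.2 = 5 / 2 :=
      (hh _).trans (toFun_point hj (by norm_num))
    have := (eq_point_two hn).2.2
    rwa [hht] at this
  have h01 : point σ 0 (5 / 2) = point σ 1 (5 / 2) :=
    h.injective ((key 0 (b0.trans_le (by norm_num))).trans (key 1 (b1.trans_le (by norm_num))).symm)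
  have := congrArg (fun z => z.1.1) h01
  rw [point_val (b0.trans_le (by norm_num)) (by norm_num),
    point_val (b1.trans_le (by norm_num)) (by norm_num)] at this
  norm_num at this

end PlanarTree

/-! ### The counterexample -/

section Main

open PlanarTree

theorem reeb_tree_facts {σ : Equiv.Perm (Fin 3)} (hσ : σ 1 = 2) (k : Type u) [Field k] :
    (tree σ).reeb.IsGeneric k ∧ (tree σ).reeb.exDgm k =
      open Classical in fun d c p => if ThreeLeafTree.diagram d c p then 1 else 0 := by
  have hiso := (threeLeafTree σ hσ).isomorphic_reeb
  obtain ⟨M⟩ := (threeLeafTree σ hσ).nonempty_of_isomorphic hiso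
  obtain ⟨N⟩ := (edgeModel σ).nonempty_of_isomorphic hiso
  have hC := N.criticalValues_eq.trans range_vertexHeight
  exact ⟨M.isGeneric k hC (N.injOn_vertices vertexHeight_injective), M.exDgm_eq k hC⟩

theorem t2Space_reeb_tree {σ : Equiv.Perm (Fin 3)} (hσ : σ 1 = 2) :
    T2Space (tree σ).reeb.carrier := by
  obtain ⟨h, -⟩ := (threeLeafTree σ hσ).isomorphic_reeb
  exact h.t2Space

theorem exists_equal_diagrams : ∃ X Y : ScalarField,
      X.IsConstructible ∧ Y.IsConstructible ∧
      PathConnectedSpace X.carrier ∧ PathConnectedSpace Y.carrier ∧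
      X.reeb.multigraph.Isomorphic Y.reeb.multigraph ∧
      ¬ X.ReebIsomorphic Y ∧
      ∀ (k : Type u) [Field k],
        X.reeb.IsGeneric k ∧ Y.reeb.IsGeneric k ∧
        X.reeb.exDgm k = Y.reeb.exDgm k ∧
        ScalarField.ungradedBottleneck k X Y = 0 ∧
        ScalarField.gradedBottleneck k X Y = 0 := by
  -- Strands 0, 1, 2 start at heights 0, 2, 1 for `σ` and at 1, 2, 0 for `τ`: leaf 2 first meets
  -- leaf 0 or leaf 1, respectively.
  let σ : Equiv.Perm (Fin 3) := Equiv.swap 1 2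
  let τ : Equiv.Perm (Fin 3) := finRotate 3
  have hσ : σ 1 = 2 := by decide
  have hτ : τ 1 = 2 := by decide
  have iσ := (threeLeafTree σ hσ).isomorphic_reeb
  have iτ := (threeLeafTree τ hτ).isomorphic_reeb
  refine ⟨tree σ, tree τ, isConstructible hσ, isConstructible hτ,
    (threeLeafTree σ hσ).pathConnectedSpace, (threeLeafTree τ hτ).pathConnectedSpace, ?_, ?_,
    fun k _ => ?_⟩
  · obtain ⟨N⟩ := (edgeModel σ).nonempty_of_isomorphic iσ
    obtain ⟨N'⟩ := (edgeModel τ).nonempty_of_isomorphic iτ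
    have := t2Space_reeb_tree hσ
    have := t2Space_reeb_tree hτ
    exact N.multigraph_isomorphic N' vertexHeight_injective vertexHeight_injective
  · intro h
    exact not_isomorphic hσ (by decide) (by decide) ((iσ.trans h).trans iτ.symm)
  · have hD := (reeb_tree_facts hσ k).2.trans (reeb_tree_facts hτ k).2.symm
    exact ⟨(reeb_tree_facts hσ k).1, (reeb_tree_facts hτ k).1, hD,
      ScalarField.ungradedBottleneck_eq_zero k hD, ScalarField.gradedBottleneck_eq_zero k hD⟩

end Main

theorem mainTheorem10 :
    (∀ (k : Type u) [Field k],
      ¬ ScalarField.IsIsomorphismInvariant (ScalarField.IsAdmissible k)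
          (ScalarField.ungradedBottleneck k) ∧
      ¬ ScalarField.IsIsomorphismInvariant (ScalarField.IsAdmissible k)
          (ScalarField.gradedBottleneck k)) ∧
    ∃ X Y : ScalarField,
      X.IsConstructible ∧ Y.IsConstructible ∧
      PathConnectedSpace X.carrier ∧ PathConnectedSpace Y.carrier ∧
      X.reeb.multigraph.Isomorphic Y.reeb.multigraph ∧
      ¬ X.ReebIsomorphic Y ∧
      ∀ (k : Type u) [Field k],
        X.reeb.IsGeneric k ∧ Y.reeb.IsGeneric k ∧
        X.reeb.exDgm k = Y.reeb.exDgm k ∧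
        ScalarField.ungradedBottleneck k X Y = 0 ∧
        ScalarField.gradedBottleneck k X Y = 0 := by
  refine ⟨fun k _ => ?_, exists_equal_diagrams⟩
  obtain ⟨X, Y, hX, hY, pX, pY, -, hn, h⟩ := exists_equal_diagrams.{u}
  obtain ⟨gX, gY, -, h1, h2⟩ := h k
  exact ⟨fun hinv => hn ((hinv X Y ⟨hX, pX, gX⟩ ⟨hY, pY, gY⟩).1 h1),
    fun hinv => hn ((hinv X Y ⟨hX, pX, gX⟩ ⟨hY, pY, gY⟩).1 h2)⟩
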